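/- Let $G$ be a finite-dimensional real Lie group with Lie algebra $\mathfrak g$ (bracket of left-invariant vector fields, $\mathrm{ad}_\xi\eta=[\xi,\eta]$). For a map $h$ from $G$ to a finite-dimensional real vector space, let $D_gh(g)\cdot\eta=\frac{d}{ds}\big|_{s=0}h(g\exp(s\eta))$ for $\eta\in\mathfrak g$. Let $T_0\le\tau_0<T_N$, let $f_1,f_2:G\times[T_0,T_N]\to\mathfrak g$ be $C^1$ modes, let $L:G\to\mathbb R$ be $C^1$ and $\varphi:G\to\mathbb R$ differentiable, and fix an initial state $x_0\in G$. For $\lambda\ge 0$ put $$f(g,\lambda;t)=\begin{cases} f_2(g;t), & \tau_0\le t<\tau_0+\lambda,\\ f_1(g;t), & \text{otherwise,}\end{cases}$$ and suppose that for all sufficiently small $\lambda\ge0$ the curve $g_\lambda:[T_0,T_N]\to G$ is the trajectory of the switched system $\dot g(t)=g(t)\,f(g(t),\lambda;t)$ with $g_\lambda(T_0)=x_0$ (continuous on $[T_0,T_N]$; at switching times $\dot g$ means the right derivative). Let $$J(\lambda)=\int_{T_0}^{T_N}L(g_\lambda(t))\,dt+\varphi(g_\lambda(T_N)),$$ and write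 $g=g_\lambda|_{\lambda=0}$ for the nominal trajectory. Then the costate equation $$\dot\rho(s)^T=-\rho(s)^T\big(D_gf_1(g(s);s)-\mathrm{ad}_{f_1(g(s);s)}\big)-D_gL(g(s)),\qquad s\in[T_0,T_N],\qquad \rho(T_N)=D_g\varphi(g(T_N)),$$ has a solution $\rho:[T_0,T_N]\to\mathfrak g^*$, and for every such $\rho$ the right derivative of $J$ at $\lambda=0$ exists and equals $$\frac{dJ}{d\lambda}\Big|_{\lambda=0^+}=\lim_{\lambda\to0^+}\frac{J(\lambda)-J(0)}{\lambda}=\rho(\tau_0)^T\big[f_2(g(\tau_0);\tau_0)-f_1(g(\tau_0);\tau_0)\big].$$ -/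

import Mathlib

open Set Filter Topology MeasureTheory
open scoped Manifold ContDiff

namespace LieSwitch

section Exponential

/-- The one-parameter subgroup with velocity `η`: the left-invariant vector field generated by
`η` has an integral curve through the identity which is defined for all times. -/
theorem exists_integralCurve {E : Type*} [NormedAddCommGroup E] [NormedSpace ℝ E]
    [FiniteDimensional ℝ E] {G : Type*} [TopologicalSpace G] [ChartedSpace E G] [Group G]
    [LieGroup 𝓘(ℝ, E) ∞ G] [T2Space G] (η : GroupLieAlgebra 𝓘(ℝ, E) G) :
    ∃ γ : ℝ → G, γ 0 = 1 ∧
      IsMIntegralCurve (I := 𝓘(ℝ, E)) γ (mulInvariantVectorField (I := 𝓘(ℝ, E)) η) := by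
  have h3 : LieGroup 𝓘(ℝ, E) (minSmoothness ℝ 3) G :=
    LieGroup.of_le (n := ∞) (by
      rw [minSmoothness_of_isRCLikeNormedField]; exact WithTop.coe_le_coe.2 (le_top : (3 : ℕ∞) ≤ ⊤))
  have : IsManifold 𝓘(ℝ, E) 1 G := IsManifold.of_le (n := ∞) (mod_cast le_top)
  have : CompleteSpace E := FiniteDimensional.complete ℝ E
  have hv : ContMDiff 𝓘(ℝ, E) 𝓘(ℝ, E).tangent 1
      (fun g : G => (mulInvariantVectorField (I := 𝓘(ℝ, E)) η g : TangentBundle 𝓘(ℝ, E) G)) :=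
    (contMDiff_mulInvariantVectorField η).of_le (by simp)
  obtain ⟨γ, h0, hγ⟩ := exists_isMIntegralCurveAt_of_contMDiffAt_boundaryless (I := 𝓘(ℝ, E)) 0
    (hv.contMDiffAt (x := (1 : G)))
  obtain ⟨ε, hε, hγ⟩ := isMIntegralCurveAt_iff'.1 hγ
  refine exists_isMIntegralCurve_of_isMIntegralCurveOn hv hε (fun x => ?_) 1
  refine ⟨fun t => x * γ t, by simp [h0], fun t ht => ?_⟩
  have hb : Metric.ball (0 : ℝ) ε = Ioo (-ε) ε := by simp [Real.ball_eq_Ioo]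
  have hd := hγ t (hb ▸ ht)
  have hx : HasMFDerivAt 𝓘(ℝ, E) 𝓘(ℝ, E) (fun y : G => x * y) (γ t)
      (mfderiv 𝓘(ℝ, E) 𝓘(ℝ, E) (fun y : G => x * y) (γ t)) :=
    ((contMDiff_mul_left (I := 𝓘(ℝ, E)) (n := ∞) (a := x)).mdifferentiable
      (by simp)).mdifferentiableAt.hasMFDerivAt
  have hc := hx.comp_hasMFDerivWithinAt t hd
  rw [hb] at hc
  have key : mulInvariantVectorField (I := 𝓘(ℝ, E)) η (x * γ t) =
      mfderiv 𝓘(ℝ, E) 𝓘(ℝ, E) (fun y : G => x * y) (γ t)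
        (mulInvariantVectorField (I := 𝓘(ℝ, E)) η (γ t)) := ?_
  · rw [key]
    have hlin : (1 : ℝ →L[ℝ] ℝ).smulRight (mfderiv 𝓘(ℝ, E) 𝓘(ℝ, E) (fun y : G => x * y) (γ t)
        (mulInvariantVectorField (I := 𝓘(ℝ, E)) η (γ t)) : E) =
        (mfderiv 𝓘(ℝ, E) 𝓘(ℝ, E) (fun y : G => x * y) (γ t) : E →L[ℝ] E).comp
          ((1 : ℝ →L[ℝ] ℝ).smulRight
            (mulInvariantVectorField (I := 𝓘(ℝ, E)) η (γ t) : E)) := by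
      ext
      simp
    exact hlin ▸ hc
  · have h1 : HasMFDerivAt 𝓘(ℝ, E) 𝓘(ℝ, E) (fun y : G => γ t * y) 1
        (mfderiv 𝓘(ℝ, E) 𝓘(ℝ, E) (fun y : G => γ t * y) 1) :=
      ((contMDiff_mul_left (I := 𝓘(ℝ, E)) (n := ∞) (a := γ t)).mdifferentiable
        (by simp)).mdifferentiableAt.hasMFDerivAt
    have h2 : HasMFDerivAt 𝓘(ℝ, E) 𝓘(ℝ, E) (fun y : G => x * y) (γ t * 1)
        (mfderiv 𝓘(ℝ, E) 𝓘(ℝ, E) (fun y : G => x * y) (γ t) : E →L[ℝ] E) := by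
      rw [mul_one]; exact hx
    have hmul : (fun y : G => x * γ t * y) = (fun y : G => x * y) ∘ (fun y : G => γ t * y) := by
      funext y; simp [mul_assoc]
    have h12 := (h2.comp 1 h1).mfderiv
    rw [← hmul] at h12
    exact congrArg (fun A : E →L[ℝ] E => A η) h12

/-- The exponential map of the Lie group `G`: the time-one value of the integral curve through
the identity of the left-invariant vector field generated by `η`. -/
noncomputable def lieExp {E : Type*} [NormedAddCommGroup E] [NormedSpace ℝ E]
    [FiniteDimensional ℝ E] {G : Type*} [TopologicalSpace G] [ChartedSpace E G] [Group G]
    [LieGroup 𝓘(ℝ, E) ∞ G] [T2Space G] (η : GroupLieAlgebra 𝓘(ℝ, E) G) : G :=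
  (exists_integralCurve η).choose 1

/-- The exponential map does not depend on the choice of the integral curve. -/
theorem lieExp_eq {E : Type*} [NormedAddCommGroup E] [NormedSpace ℝ E]
    [FiniteDimensional ℝ E] {G : Type*} [TopologicalSpace G] [ChartedSpace E G] [Group G]
    [LieGroup 𝓘(ℝ, E) ∞ G] [T2Space G] (η : GroupLieAlgebra 𝓘(ℝ, E) G) (γ : ℝ → G)
    (h0 : γ 0 = 1)
    (hγ : IsMIntegralCurve (I := 𝓘(ℝ, E)) γ (mulInvariantVectorField (I := 𝓘(ℝ, E)) η)) :
    lieExp η = γ 1 := by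
  have h3 : LieGroup 𝓘(ℝ, E) (minSmoothness ℝ 3) G :=
    LieGroup.of_le (n := ∞) (by
      rw [minSmoothness_of_isRCLikeNormedField]; exact WithTop.coe_le_coe.2 (le_top : (3 : ℕ∞) ≤ ⊤))
  have : IsManifold 𝓘(ℝ, E) 1 G := IsManifold.of_le (n := ∞) (mod_cast le_top)
  have hv : ContMDiff 𝓘(ℝ, E) 𝓘(ℝ, E).tangent 1
      (fun g : G => (mulInvariantVectorField (I := 𝓘(ℝ, E)) η g : TangentBundle 𝓘(ℝ, E) G)) :=
    (contMDiff_mulInvariantVectorField η).of_le (by simp)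
  have hs := (exists_integralCurve η).choose_spec
  exact congrFun (isMIntegralCurve_Ioo_eq_of_contMDiff_boundaryless (t₀ := 0) hv hs.2 hγ
    (hs.1.trans h0.symm)) 1

end Exponential

section Calculus

/-- The left-trivialized derivative `D_g f|_g · η = d/ds f (g exp (s η))` at `s = 0`. -/
noncomputable def leftDeriv {E : Type*} [NormedAddCommGroup E] [NormedSpace ℝ E]
    [FiniteDimensional ℝ E] {G : Type*} [TopologicalSpace G] [ChartedSpace E G] [Group G]
    [LieGroup 𝓘(ℝ, E) ∞ G] [T2Space G]
    {F : Type*} [AddCommGroup F] [Module ℝ F] [TopologicalSpace F]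
    (f : G → F) (g : G) (η : GroupLieAlgebra 𝓘(ℝ, E) G) : F :=
  deriv (fun s : ℝ => f (g * lieExp (s • η))) 0

end Calculus

section Switched

/-- The inserted system: mode `f₂` on `[τ₀, τ₀ + lam)`, mode `f₁` at all other times. -/
noncomputable def insertedMode {G V : Type*} (f₁ f₂ : G → ℝ → V) (τ₀ lam : ℝ) : G → ℝ → V :=
  open Classical in
  fun g t => if τ₀ ≤ t ∧ t < τ₀ + lam then f₂ g t else f₁ g t

/-- `g` is the trajectory on `[T₀, TN]`, starting at `g₀`, of the system `ġ = g ξ`,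
`ξ = f (g, t)`. The left translate `g ξ` is the value at `g` of the left-invariant field generated
by `ξ`. The curve is continuous, and at every time of `[T₀, TN)` its right derivative is the
prescribed one: the switched right-hand side is right-continuous in time (away from the
switching times this is the ordinary derivative). -/
structure IsTrajectory {E : Type*} [NormedAddCommGroup E] [NormedSpace ℝ E]
    {G : Type*} [TopologicalSpace G] [ChartedSpace E G] [Group G]
    (f : G → ℝ → GroupLieAlgebra 𝓘(ℝ, E) G) (T₀ TN : ℝ) (g₀ : G) (g : ℝ → G) : Prop where
  init : g T₀ = g₀
  cont : ContinuousOn g (Icc T₀ TN)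
  ode : ∀ t ∈ Ico T₀ TN, HasMFDerivWithinAt 𝓘(ℝ, ℝ) 𝓘(ℝ, E) g (Ici t) t
    ((1 : ℝ →L[ℝ] ℝ).smulRight (mulInvariantVectorField (I := 𝓘(ℝ, E)) (f (g t) t) (g t)))

/-- The objective `∫ L(g(t)) dt + φ(g(TN))` along a curve. -/
noncomputable def cost {G : Type*} (L φ : G → ℝ) (T₀ TN : ℝ) (g : ℝ → G) : ℝ :=
  (∫ t in T₀..TN, L (g t)) + φ (g TN)

/-- `ρ` is the costate on `[T₀, TN]` along the curve `g`:
`ρ̇ᵀ = -ρᵀ (D_g f - ad_f) - D_g L` and `ρ(TN) = D_g φ (g(TN))`, as equalities of linear forms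
on the Lie algebra. -/
structure IsCostate {E : Type*} [NormedAddCommGroup E] [NormedSpace ℝ E]
    [FiniteDimensional ℝ E] {G : Type*} [TopologicalSpace G] [ChartedSpace E G] [Group G]
    [LieGroup 𝓘(ℝ, E) ∞ G] [T2Space G]
    (f : G → ℝ → GroupLieAlgebra 𝓘(ℝ, E) G) (L φ : G → ℝ) (T₀ TN : ℝ) (g : ℝ → G)
    (ρ : ℝ → Module.Dual ℝ (GroupLieAlgebra 𝓘(ℝ, E) G)) : Prop where
  ode : ∀ s ∈ Icc T₀ TN, ∀ η : GroupLieAlgebra 𝓘(ℝ, E) G,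
    HasDerivWithinAt (fun t => ρ t η)
      (-(ρ s (leftDeriv (fun x => f x s) (g s) η - ⁅f (g s) s, η⁆)) - leftDeriv L (g s) η)
      (Icc T₀ TN) s
  terminal : ∀ η : GroupLieAlgebra 𝓘(ℝ, E) G, ρ TN η = leftDeriv φ (g TN) η

end Switched

end LieSwitch

/-! The perturbed and nominal trajectories are compared through the quotient `g⁻¹ g_λ`. It stays
near the identity on the whole time interval, so one chart at the identity suffices even though the
nominal curve may cross many charts. Let `e` be the coordinates of the identity and `m` the
multiplication in that chart. With `ℓ(x) = ∂₂m(x, e)` and `r(x) = ∂₁m(e, x)`, the quotient obeys `ẋ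
= ℓ(x) f(g x, t) - r(x) f₁(g, t)` (`hasDerivWithinAt_chart_inv_mul_curves`). For `f = f₁` the
identity is an equilibrium. The linearization there is `D_g f₁ - ad_{f₁}`, because the mixed second
derivative of `m` at `(e, e)` enters once through `ℓ` and once, with arguments exchanged, through
`r`, and its antisymmetrization is the bracket (`relativeFieldDeriv_chartOne`).

Grönwall bounds show that the displacement vanishes up to `τ₀` and is `O(λ)` afterwards
(`exists_norm_chart_le`). During the needle the velocity is `f₂ - f₁` up to `o(1)`. If `ρ` solves
the costate equation, then `ρ(x) + ∫ (L(g_λ) - L(g))` grows by `λ ρ(τ₀)(f₂ - f₁) + o(λ)` on the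
needle and only by `o(λ)` afterwards, since the linear terms cancel (`isLittleO_needle`). The
terminal condition on `ρ` identifies the final value with `J(λ) - J(0)` up to `o(λ)`;
differentiability of `φ` at the single point `g(T_N)` is enough for this.

Existence of `ρ` is solvability of a linear equation with continuous coefficients on a compact
interval (`exists_hasDerivWithinAt_affine_terminal`), after `isCostate_iff` has rewritten the
intrinsic costate equation in the chart. -/

/-! ### Differential equations and needle variations in normed spaces. -/

/-- A linear inhomogeneous differential equation with continuous coefficients on a compact interval
has a solution with any prescribed terminal value. -/
theorem exists_hasDerivWithinAt_affine_terminal {X : Type*} [NormedAddCommGroup X]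
    [NormedSpace ℝ X] [CompleteSpace X] {a b : ℝ} (hab : a ≤ b) {B : ℝ → X →L[ℝ] X} {c : ℝ → X}
    (hB : ContinuousOn B (Icc a b)) (hc : ContinuousOn c (Icc a b)) (y₁ : X) :
    ∃ y : ℝ → X, y b = y₁ ∧
      ∀ t ∈ Icc a b, HasDerivWithinAt y (B t (y t) + c t) (Icc a b) t := by
  -- Extending the coefficients by their endpoint values makes them continuous and bounded on all of
  -- `ℝ`.
  set B' : ℝ → X →L[ℝ] X := IccExtend hab ((Icc a b).domRestrict B)
  set c' : ℝ → X := IccExtend hab ((Icc a b).domRestrict c)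
  have hB' : Continuous B' := hB.domRestrict.Icc_extend'
  have hc' : Continuous c' := hc.domRestrict.Icc_extend'
  obtain ⟨K, hK0, hK⟩ : ∃ K : ℝ, 0 ≤ K ∧ ∀ s, ‖B' s‖ ≤ K := by
    obtain ⟨K, hK⟩ := isCompact_Icc.exists_bound_of_continuousOn hB
    exact ⟨K, (norm_nonneg _).trans (hK a ⟨le_rfl, hab⟩), fun s => hK _ (projIcc a b hab s).2⟩
  -- Bielecki's weight: the unknown is `z(s) = exp(w (s - b)) y(s)`, and in the sup norm of `z` the
  -- Picard operator based at `b` has Lipschitz constant `K / w ≤ 1/2`. One contraction thus covers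
  -- the whole interval, whatever its length.
  set w : ℝ := 2 * (K + 1)
  have hw : 0 < w := by positivity
  let v : C(Icc a b, X) → ℝ → X := fun z s =>
    Real.exp (-w * (s - b)) • z (projIcc a b hab s)
  have hv : ∀ z, Continuous (v z) := fun z => by
    have : Continuous fun s => z (projIcc a b hab s) := z.continuous.comp continuous_projIcc
    fun_prop
  let u : C(Icc a b, X) → ℝ → X := fun z s => B' s (v z s) + c' s
  have hu : ∀ z, Continuous (u z) := fun z => (hB'.clm_apply (hv z)).add hc'
  have hprim : ∀ z, Continuous fun t => ∫ s in b..t, u z s := fun z =>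
    intervalIntegral.continuous_primitive (fun _ _ => (hu z).intervalIntegrable _ _) b
  let T : C(Icc a b, X) → C(Icc a b, X) := fun z =>
    ⟨fun t => Real.exp (w * ((t : ℝ) - b)) • (y₁ + ∫ s in b..(t : ℝ), u z s), by
      have := (hprim z).comp (continuous_subtype_val (p := (· ∈ Icc a b)))
      simp only [Function.comp_def] at this
      fun_prop⟩
  have hT : ContractingWith (1 / 2) T := by
    refine ⟨by rw [div_lt_one] <;> norm_num, LipschitzWith.of_dist_le_mul fun z₁ z₂ => ?_⟩
    rw [ContinuousMap.dist_le (by positivity)]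
    intro t
    have hd : ∀ s, ‖u z₁ s - u z₂ s‖ ≤ K * dist z₁ z₂ * Real.exp (-w * (s - b)) := fun s => by
      have h1 : u z₁ s - u z₂ s = B' s (Real.exp (-w * (s - b)) •
          (z₁ (projIcc a b hab s) - z₂ (projIcc a b hab s))) := by
        simp only [u, v, smul_sub, map_sub]; abel
      rw [h1]
      refine ((B' s).le_opNorm _).trans ?_
      rw [norm_smul, Real.norm_eq_abs, Real.abs_exp, ← dist_eq_norm]
      have := ContinuousMap.dist_apply_le_dist (f := z₁) (g := z₂) (projIcc a b hab s)
      calc _ ≤ K * (Real.exp (-w * (s - b)) * dist z₁ z₂) := by gcongr; exact hK s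
        _ = _ := by ring
    have hi : ∫ s in (t : ℝ)..b, K * dist z₁ z₂ * Real.exp (-w * (s - b)) =
        K * dist z₁ z₂ * ((Real.exp (-w * ((t : ℝ) - b)) - 1) / w) := by
      rw [intervalIntegral.integral_const_mul]
      congr 1
      rw [intervalIntegral.integral_eq_sub_of_hasDerivAt
        (f := fun s => -Real.exp (-w * (s - b)) / w)]
      · simp; ring
      · intro s _
        have := ((((hasDerivAt_id s).sub_const b).const_mul (-w)).exp.neg).div_const w
        convert! this using 1
        simp only [id]
        field_simp
      · exact Continuous.intervalIntegrable (by fun_prop) _ _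
    have h2 : T z₁ t - T z₂ t = Real.exp (w * ((t : ℝ) - b)) •
        (-∫ s in (t : ℝ)..b, (u z₁ s - u z₂ s)) := by
      rw [← intervalIntegral.integral_symm, intervalIntegral.integral_sub
        ((hu z₁).intervalIntegrable _ _) ((hu z₂).intervalIntegrable _ _)]
      simp only [T, ContinuousMap.coe_mk, ← smul_sub]
      congr 1; abel
    have h3 : ‖∫ s in (t : ℝ)..b, (u z₁ s - u z₂ s)‖ ≤
        K * dist z₁ z₂ * ((Real.exp (-w * ((t : ℝ) - b)) - 1) / w) := by
      rw [← hi]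
      exact intervalIntegral.norm_integral_le_of_norm_le t.2.2
        (Eventually.of_forall fun s _ => hd s)
        (Continuous.intervalIntegrable (by fun_prop) _ _)
    rw [dist_eq_norm, h2, norm_smul, norm_neg, Real.norm_eq_abs, Real.abs_exp]
    have h4 : Real.exp (w * ((t : ℝ) - b)) * Real.exp (-w * ((t : ℝ) - b)) = 1 := by
      rw [← Real.exp_add]; simp
    have h5 : 0 < Real.exp (w * ((t : ℝ) - b)) := Real.exp_pos _
    have hd0 : 0 ≤ dist z₁ z₂ := dist_nonneg
    calc _ ≤ Real.exp (w * ((t : ℝ) - b)) *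
          (K * dist z₁ z₂ * ((Real.exp (-w * ((t : ℝ) - b)) - 1) / w)) := by gcongr
      _ = K * dist z₁ z₂ * ((1 - Real.exp (w * ((t : ℝ) - b))) / w) := by
          linear_combination (K * dist z₁ z₂ / w) * h4
      _ ≤ K * dist z₁ z₂ * (1 / w) := by gcongr; linarith
      _ = (K / w) * dist z₁ z₂ := by ring
      _ ≤ (1 / 2) * dist z₁ z₂ := by
          refine mul_le_mul_of_nonneg_right ?_ hd0
          rw [div_le_div_iff₀ hw two_pos]
          simp only [w]; linarith
      _ = _ := by simp
  have hne : Nonempty C(Icc a b, X) := ⟨0⟩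
  obtain ⟨z, hz⟩ : ∃ z, T z = z := ⟨hT.fixedPoint T, hT.fixedPoint_isFixedPt⟩
  have hzt : ∀ t (ht : t ∈ Icc a b), v z t = y₁ + ∫ s in b..t, u z s := fun t ht => by
    have h1 : z ⟨t, ht⟩ = Real.exp (w * (t - b)) • (y₁ + ∫ s in b..t, u z s) := by
      conv_lhs => rw [← hz]
      rfl
    simp only [v, projIcc_of_mem hab ht]
    rw [h1, smul_smul, ← Real.exp_add]
    simp
  refine ⟨v z, ?_, fun t ht => ?_⟩
  · simpa using hzt b ⟨hab, le_rfl⟩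
  · have h1 : HasDerivAt (fun t => y₁ + ∫ s in b..t, u z s) (u z t) t :=
      (intervalIntegral.integral_hasDerivAt_right ((hu z).intervalIntegrable _ _)
        ((hu z).stronglyMeasurableAtFilter _ _) (hu z).continuousAt).const_add _
    have h2 : u z t = B t (v z t) + c t := by
      simp only [u, B', c', IccExtend_of_mem hab _ ht, domRestrict_apply]
    rw [← h2]
    exact h1.hasDerivWithinAt.congr hzt (hzt t ht)

/-- First-order expansions at a point, uniform with respect to a parameter in a compact set. -/
theorem exists_uniform_linearization {X V : Type*} [NormedAddCommGroup X] [NormedSpace ℝ X]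
    [NormedAddCommGroup V] [NormedSpace ℝ V] {S : Set ℝ} (hS : IsCompact S) {U : Set X}
    (hU : IsOpen U) {e : X} (he : e ∈ U) {P : ℝ → X → V} {D : ℝ → X → X →L[ℝ] V}
    (hP : ∀ t ∈ S, ∀ x ∈ U, HasFDerivAt (P t) (D t x) x)
    (hD : ContinuousOn (fun p : ℝ × X => D p.1 p.2) (S ×ˢ U)) {ε : ℝ} (hε : 0 < ε) :
    ∃ δ > 0, ∀ t ∈ S, ∀ x, ‖x - e‖ ≤ δ → ‖P t x - P t e - D t e (x - e)‖ ≤ ε * ‖x - e‖ := by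
  have h1 : ∀ t ∈ S, ∀ᶠ p : ℝ × X in 𝓝[S] t ×ˢ 𝓝 e, p.2 ∈ U ∧ ‖D p.1 p.2 - D p.1 e‖ ≤ ε := by
    intro t ht
    have hc : Tendsto (fun p : ℝ × X => D p.1 p.2) (𝓝[S] t ×ˢ 𝓝 e) (𝓝 (D t e)) := by
      have := hD (t, e) ⟨ht, he⟩
      rwa [ContinuousWithinAt, nhdsWithin_prod_eq, hU.nhdsWithin_eq he] at this
    have hc2 : Tendsto (fun p : ℝ × X => D p.1 e) (𝓝[S] t ×ˢ 𝓝 e) (𝓝 (D t e)) :=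
      hc.comp (tendsto_fst.prodMk (tendsto_const_nhds (x := e)))
    have h3 := (hc.sub hc2).norm
    rw [sub_self, norm_zero] at h3
    filter_upwards [h3.eventually (gt_mem_nhds hε), tendsto_snd.eventually (hU.mem_nhds he)]
      with p hp hp2 using ⟨hp2, hp.le⟩
  -- Tube-lemma argument: by compactness of `S` the neighbourhoods of `e` obtained near each `t`
  -- have a common one.
  have h2 : ∀ᶠ x in 𝓝 e, ∀ t ∈ S, x ∈ U ∧ ‖D t x - D t e‖ ≤ ε := by
    refine hS.induction_on (p := fun S' => ∀ᶠ x in 𝓝 e, ∀ t ∈ S', x ∈ U ∧ ‖D t x - D t e‖ ≤ ε)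
      (by simp) (fun s t hst ht => ht.mono fun x hx u hu => hx u (hst hu))
      (fun s t hs ht => ?_) (fun t ht => ?_)
    · filter_upwards [hs, ht] with x h1 h2 u hu using hu.elim (h1 u) (h2 u)
    · obtain ⟨p, hp, q, hq, hpq⟩ := eventually_prod_iff.1 (h1 t ht)
      exact ⟨{s | p s}, hp, hq.mono fun x hx s hs => hpq hs hx⟩
  obtain ⟨δ, hδ, h⟩ := Metric.eventually_nhds_iff_ball.1 h2
  refine ⟨δ / 2, by positivity, fun t ht x hx => ?_⟩
  have hx' : x ∈ Metric.ball e δ := by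
    rw [Metric.mem_ball, dist_eq_norm]; linarith
  -- Mean value inequality for `P t - D t e`, whose derivative has norm at most `ε` on the ball.
  have := (convex_ball e δ).norm_image_sub_le_of_norm_hasFDerivWithin_le' (φ := D t e)
    (fun y hy => (hP t ht y (h y hy t ht).1).hasFDerivWithinAt)
    (fun y hy => (h y hy t ht).2) (Metric.mem_ball_self hδ) hx'
  exact this

/-- A curve in a manifold starting near the centre of a chart stays in the chart and satisfies a
Grönwall bound there, as long as that bound is smaller than the radius of the chart ball. -/
theorem norm_chart_le_gronwallBound {X M : Type*} [NormedAddCommGroup X] [NormedSpace ℝ X]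
    [FiniteDimensional ℝ X] [TopologicalSpace M] [T2Space M] (χ : OpenPartialHomeomorph M X)
    {e : X} {r : ℝ} (hr : Metric.ball e r ⊆ χ.target) {h : ℝ → M} {a b δ K ε : ℝ}
    (hδ : 0 ≤ δ) (hK : 0 ≤ K) (hε : 0 ≤ ε) (hab : a ≤ b)
    (hc : ContinuousOn h (Icc a b)) (ha : h a ∈ χ.source) (haδ : ‖χ (h a) - e‖ ≤ δ)
    (hderiv : ∀ t ∈ Ico a b, h t ∈ χ.source → ‖χ (h t) - e‖ < r →
      ∃ v, HasDerivWithinAt (fun s => χ (h s)) v (Ici t) t ∧ ‖v‖ ≤ K * ‖χ (h t) - e‖ + ε)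
    (hlt : gronwallBound δ K ε (b - a) < r) :
    ∀ t ∈ Icc a b, h t ∈ χ.source ∧ ‖χ (h t) - e‖ ≤ gronwallBound δ K ε (t - a) := by
  have hmono := gronwallBound_mono hδ hε hK
  set W : Set M := χ.source ∩ χ ⁻¹' Metric.ball e r with hWdef
  have hW : IsOpen W := χ.isOpen_inter_preimage Metric.isOpen_ball
  have hmemW : ∀ g, g ∈ W ↔ g ∈ χ.source ∧ ‖χ g - e‖ < r := fun g => by
    simp [W, Metric.mem_ball, dist_eq_norm]
  have hδr : δ < r := by
    have := hmono (sub_nonneg.2 hab)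
    rw [gronwallBound_x0] at this
    exact this.trans_lt hlt
  have key : ∀ c ≤ b, (∀ t ∈ Icc a c, h t ∈ W) →
      ∀ t ∈ Icc a c, ‖χ (h t) - e‖ ≤ gronwallBound δ K ε (t - a) := by
    intro c hcb hcW
    -- The Grönwall lemma wants the derivative as a total function of time; outside the relevant
    -- interval the value 0 is a dummy.
    have hch : ∀ t : Icc a b, ∃ v, t.1 ∈ Ico a c →
        HasDerivWithinAt (fun s => χ (h s)) v (Ici t.1) t.1 ∧
          ‖v‖ ≤ K * ‖χ (h t) - e‖ + ε := fun t => by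
      by_cases ht : t.1 ∈ Ico a c
      · have h1 := (hmemW _).1 (hcW _ ⟨ht.1, ht.2.le⟩)
        obtain ⟨v, hv⟩ := hderiv t.1 ⟨ht.1, ht.2.trans_le hcb⟩ h1.1 h1.2
        exact ⟨v, fun _ => hv⟩
      · exact ⟨0, fun h => absurd h ht⟩
    choose f' hf' using hch
    have hcont : ContinuousOn (fun t => χ (h t) - e) (Icc a c) := by
      refine ContinuousOn.sub ?_ continuousOn_const
      exact χ.continuousOn.comp (hc.mono (Icc_subset_Icc_right hcb)) fun t ht => (hcW t ht).1
    have hm : ∀ t ∈ Ico a c, t ∈ Icc a b := fun t ht => ⟨ht.1, (ht.2.trans_le hcb).le⟩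
    refine norm_le_gronwallBound_of_norm_deriv_right_le
      (f' := fun t => if ht : t ∈ Icc a b then f' ⟨t, ht⟩ else 0) hcont ?_ haδ ?_
    · intro t ht
      simp only [hm t ht, dif_pos]
      exact (hf' ⟨t, hm t ht⟩ ht).1.sub_const e
    · intro t ht
      simp only [hm t ht, dif_pos]
      exact (hf' ⟨t, hm t ht⟩ ht).2
  -- Continuation: at a first exit time `t₁` from the chart ball, the Grönwall bound holds at all
  -- earlier times, which forces `h t₁` to lie in the ball after all.
  have hall : ∀ t ∈ Icc a b, h t ∈ W := by
    by_contra! hne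
    set S : Set ℝ := Icc a b ∩ h ⁻¹' Wᶜ
    have hScl : IsClosed S := hc.preimage_isClosed_of_isClosed isClosed_Icc hW.isClosed_compl
    have hSc : IsCompact S := isCompact_Icc.of_isClosed_subset hScl inter_subset_left
    have hSne : S.Nonempty := let ⟨t, ht, htW⟩ := hne; ⟨t, ht, htW⟩
    obtain ⟨t₁, ht₁, hmin⟩ := hSc.exists_isLeast hSne
    have hbefore : ∀ t ∈ Ico a t₁, h t ∈ W := fun t ht => by
      by_contra hcon
      exact absurd (hmin ⟨⟨ht.1, ht.2.le.trans ht₁.1.2⟩, hcon⟩) (not_le.2 ht.2)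
    have hat₁ : a < t₁ := by
      refine lt_of_le_of_ne ht₁.1.1 fun h0 => ht₁.2 ?_
      rw [← h0]
      exact (hmemW _).2 ⟨ha, haδ.trans_lt hδr⟩
    set r' := gronwallBound δ K ε (b - a)
    -- The coordinates say nothing about a limit point outside the chart domain. This image is
    -- compact, hence closed in the Hausdorff space `M`, so the curve cannot leave the domain while
    -- its coordinates stay in the smaller closed ball.
    set C : Set M := χ.symm '' Metric.closedBall e r'
    have hbr : Metric.closedBall e r' ⊆ Metric.ball e r := Metric.closedBall_subset_ball hlt
    have hCc : IsClosed C := by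
      have : ProperSpace X := FiniteDimensional.proper ℝ X
      exact ((isCompact_closedBall e r').image_of_continuousOn
        (χ.continuousOn_symm.mono (hbr.trans hr))).isClosed
    have hCmem : ∀ t ∈ Ico a t₁, h t ∈ C := fun t ht => by
      have h1 := key t (ht.2.le.trans ht₁.1.2)
        (fun s hs => hbefore s ⟨hs.1, hs.2.trans_lt ht.2⟩) t ⟨ht.1, le_rfl⟩
      refine ⟨χ (h t), ?_, χ.left_inv (hbefore t ht).1⟩
      rw [Metric.mem_closedBall, dist_eq_norm]
      exact h1.trans (hmono (by linarith [ht.2, ht₁.1.2]))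
    have hlim : h t₁ ∈ C := by
      have hcl : t₁ ∈ closure (Ico a t₁) := by
        rw [closure_Ico hat₁.ne]; exact ⟨hat₁.le, le_rfl⟩
      have hct : ContinuousWithinAt h (Ico a t₁) t₁ := (hc t₁ ht₁.1).mono fun s hs =>
        ⟨hs.1, hs.2.le.trans ht₁.1.2⟩
      exact hCc.closure_subset (hct.mem_closure hcl hCmem)
    obtain ⟨x, hx, hxt⟩ := hlim
    refine ht₁.2 ?_
    rw [← hxt]
    refine ⟨χ.map_target (hr (hbr hx)), ?_⟩
    rw [mem_preimage, χ.right_inv (hr (hbr hx))]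
    exact hbr hx
  exact fun t ht => ⟨(hall t ht).1, key b le_rfl hall t ht⟩

/-- First-order effect of a needle variation in coordinates: the curve `x lam` vanishes up to
time `τ`, follows `F₂` during the needle `[τ, τ + lam)` and `F₁` afterwards. The adjoint variable
`ρ` transports the effect of the needle on the terminal and running costs back to time `τ`. -/
theorem isLittleO_needle {X : Type*} [NormedAddCommGroup X] [NormedSpace ℝ X]
    {τ b C K : ℝ} (hτ : τ < b) (hC : 0 ≤ C)
    {x : ℝ → ℝ → X} {F₁ F₂ : ℝ → X → X} {A : ℝ → X →L[ℝ] X} {l : ℝ → X → ℝ}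
    {dl ρ : ℝ → X →L[ℝ] ℝ} {w : X}
    (hxc : ∀ᶠ lam in 𝓝[>] (0 : ℝ), ContinuousOn (x lam) (Icc τ b))
    (hx0 : ∀ᶠ lam in 𝓝[>] (0 : ℝ), x lam τ = 0)
    (hx2 : ∀ᶠ lam in 𝓝[>] (0 : ℝ), ∀ t ∈ Ico τ (τ + lam),
      HasDerivWithinAt (x lam) (F₂ t (x lam t)) (Ici t) t)
    (hx1 : ∀ᶠ lam in 𝓝[>] (0 : ℝ), ∀ t ∈ Ico (τ + lam) b,
      HasDerivWithinAt (x lam) (F₁ t (x lam t)) (Ici t) t)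
    (hxC : ∀ᶠ lam in 𝓝[>] (0 : ℝ), ∀ t ∈ Icc τ b, ‖x lam t‖ ≤ C * lam)
    (hlc : ∀ᶠ lam in 𝓝[>] (0 : ℝ), ContinuousOn (fun t => l t (x lam t)) (Icc τ b))
    (hF₁ : ∀ ε > 0, ∃ δ > 0, ∀ t ∈ Icc τ b, ∀ y, ‖y‖ ≤ δ → ‖F₁ t y - A t y‖ ≤ ε * ‖y‖)
    (hl : ∀ ε > 0, ∃ δ > 0, ∀ t ∈ Icc τ b, ∀ y, ‖y‖ ≤ δ → ‖l t y - dl t y‖ ≤ ε * ‖y‖)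
    (hF₂ : Tendsto (fun p : ℝ × X => F₂ p.1 p.2) (𝓝[Icc τ b] τ ×ˢ 𝓝 0) (𝓝 w))
    (hA : ∀ t ∈ Icc τ b, ‖A t‖ ≤ K) (hdl : ∀ t ∈ Icc τ b, ‖dl t‖ ≤ K)
    (hρ : ∀ t ∈ Icc τ b, HasDerivWithinAt ρ (-(ρ t ∘L A t) - dl t) (Icc τ b) t) :
    (fun lam => ρ b (x lam b) + (∫ t in τ..b, l t (x lam t)) - lam * ρ τ w)
      =o[𝓝[>] (0 : ℝ)] fun lam => lam := by
  have hρc : ContinuousOn ρ (Icc τ b) := fun t ht => (hρ t ht).continuousWithinAt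
  obtain ⟨R, hR⟩ := isCompact_Icc.exists_bound_of_continuousOn hρc
  have hτm : τ ∈ Icc τ b := ⟨le_rfl, hτ.le⟩
  have hR0 : 0 ≤ R := (norm_nonneg _).trans (hR τ hτm)
  have hK0 : 0 ≤ K := (norm_nonneg _).trans (hA τ hτm)
  have hlam0 : Tendsto (fun lam : ℝ => C * lam) (𝓝[>] (0 : ℝ)) (𝓝 0) := by
    have : Tendsto (fun lam : ℝ => C * lam) (𝓝 (0 : ℝ)) (𝓝 (C * 0)) :=
      (continuous_const.mul continuous_id).tendsto _
    rw [mul_zero] at this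
    exact this.mono_left nhdsWithin_le_nhds
  rw [Asymptotics.isLittleO_iff]
  intro ε hε
  -- the error on the needle
  have hρF : Tendsto (fun p : ℝ × X => ρ p.1 (F₂ p.1 p.2)) (𝓝[Icc τ b] τ ×ˢ 𝓝 0)
      (𝓝 (ρ τ w)) := by
    have h1 : Tendsto (fun p : ℝ × X => ρ p.1) (𝓝[Icc τ b] τ ×ˢ 𝓝 0) (𝓝 (ρ τ)) :=
      (hρc τ hτm).tendsto.comp tendsto_fst
    exact (isBoundedBilinearMap_apply.continuous.tendsto (ρ τ, w)).comp (h1.prodMk_nhds hF₂)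
  have hρF' := (tendsto_iff_norm_sub_tendsto_zero.1 hρF).eventually (gt_mem_nhds (half_pos
    (half_pos hε)))
  obtain ⟨p, hp, q, hq, hpq⟩ := eventually_prod_iff.1 hρF'
  obtain ⟨δ₂, hδ₂, hp⟩ := Metric.mem_nhdsWithin_iff.1 hp
  obtain ⟨δ₃, hδ₃, hq⟩ := Metric.eventually_nhds_iff_ball.1 hq
  -- the error after the needle
  set ε₁ : ℝ := ε / (2 * ((R + 1) * (C + 1) * (b - τ)))
  have hbτ : 0 < b - τ := sub_pos.2 hτ
  have hε₁ : 0 < ε₁ := by positivity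
  obtain ⟨δF, hδF, hF₁⟩ := hF₁ ε₁ hε₁
  obtain ⟨δl, hδl, hl₁⟩ := hl ε₁ hε₁
  obtain ⟨δm, hδm, hlm⟩ := hl 1 one_pos
  -- On the needle, `ρ̇ x` and `l` are bounded by `R K + K` and `1 + K` times `C λ`; the 1 comes
  -- from linearizing `l` with tolerance 1.
  set Q : ℝ := (R * K + K) + (1 + K)
  have hsmall : ∀ ⦃δ : ℝ⦄, 0 < δ → ∀ᶠ lam in 𝓝[>] (0 : ℝ), C * lam < δ := fun δ hδ =>
    hlam0.eventually (gt_mem_nhds hδ)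
  have hQ : ∀ᶠ lam in 𝓝[>] (0 : ℝ), Q * (C * lam) < ε / 2 / 2 := by
    have := hlam0.const_mul Q
    rw [mul_zero] at this
    exact this.eventually (gt_mem_nhds (by positivity))
  have hlt : ∀ ⦃δ : ℝ⦄, 0 < δ → ∀ᶠ lam in 𝓝[>] (0 : ℝ), lam < δ := fun δ hδ =>
    nhdsWithin_le_nhds (gt_mem_nhds hδ)
  filter_upwards [hxc, hx0, hx2, hx1, hxC, hlc, hsmall hδF, hsmall hδl, hsmall hδm, hsmall hδ₃,
    hQ, hlt hδ₂, hlt hbτ, self_mem_nhdsWithin] with lam hxc hx0 hx2 hx1 hxC hlc hsF hsl hsm hs3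
    hQ hl2 hlb hpos
  rw [mem_Ioi] at hpos
  -- Adjoint pairing plus accumulated running cost; it starts at 0, and its linear part is conserved
  -- by the linearized `F₁` motion.
  let W : ℝ → ℝ := fun t => ρ t (x lam t) + ∫ s in τ..t, l s (x lam s)
  have hWc : ContinuousOn W (Icc τ b) := by
    refine (hρc.clm_apply hxc).add ?_
    have := intervalIntegral.continuousOn_primitive_interval
      (f := fun s => l s (x lam s)) (μ := volume) (a := τ) (b := b)
      (by rw [uIcc_of_le hτ.le]; exact hlc.integrableOn_Icc)
    rwa [uIcc_of_le hτ.le] at this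
  have hder : ∀ t ∈ Ico τ b, ∀ v, HasDerivWithinAt (x lam) v (Ici t) t →
      HasDerivWithinAt W (((-(ρ t ∘L A t) - dl t) (x lam t) + ρ t v) + l t (x lam t))
        (Ici t) t := by
    intro t ht v hv
    have htm : t ∈ Icc τ b := ⟨ht.1, ht.2.le⟩
    have hnhd : Icc τ b ∈ 𝓝[≥] t :=
      mem_of_superset (Icc_mem_nhdsGE ht.2) (Icc_subset_Icc_left ht.1)
    have h1 : HasDerivWithinAt ρ (-(ρ t ∘L A t) - dl t) (Ici t) t :=
      (hρ t htm).mono_of_mem_nhdsWithin hnhd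
    have hlcw : ContinuousWithinAt (fun s => l s (x lam s)) (Ici t) t :=
      (hlc t htm).mono_of_mem_nhdsWithin hnhd
    refine (h1.clm_apply hv).add ?_
    refine intervalIntegral.integral_hasDerivWithinAt_right (t := Ioi t) ?_ ?_
      (hlcw.mono Ioi_subset_Ici_self)
    · refine ContinuousOn.intervalIntegrable ?_
      rw [uIcc_of_le ht.1]
      exact hlc.mono (Icc_subset_Icc_right ht.2.le)
    · exact ⟨Icc τ b, mem_of_superset (nhdsWithin_mono _ Ioi_subset_Ici_self hnhd) subset_rfl,
        hlc.aestronglyMeasurable measurableSet_Icc⟩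
  have hlx : ∀ t ∈ Icc τ b, ‖l t (x lam t)‖ ≤ (1 + K) * (C * lam) := fun t ht => by
    have h1 := hlm t ht _ ((hxC t ht).trans hsm.le)
    have h2 := (dl t).le_of_opNorm_le_of_le (hdl t ht) (hxC t ht)
    have h3 := norm_add_le (l t (x lam t) - dl t (x lam t)) (dl t (x lam t))
    rw [sub_add_cancel] at h3
    have := hxC t ht
    linarith
  have hρ'x : ∀ t ∈ Icc τ b, ‖(-(ρ t ∘L A t) - dl t) (x lam t)‖ ≤ (R * K + K) * (C * lam) :=
    fun t ht => by
      refine ContinuousLinearMap.le_of_opNorm_le_of_le _ ?_ (hxC t ht)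
      refine (norm_sub_le _ _).trans (add_le_add ?_ (hdl t ht))
      rw [norm_neg]
      exact (ContinuousLinearMap.opNorm_comp_le _ _).trans
        (mul_le_mul (hR t ht) (hA t ht) (norm_nonneg _) hR0)
  have hlamb : τ + lam ∈ Icc τ b := ⟨by linarith, by linarith⟩
  have hneedle : ‖W (τ + lam) - lam * ρ τ w‖ ≤ ε / 2 * lam := by
    -- After subtracting the expected growth `(t - τ) ρ τ w`, the remaining slope is at most `ε /
    -- 2`.
    have hW' : ∀ t ∈ Ico τ (τ + lam), HasDerivWithinAt (fun t => W t - (t - τ) * ρ τ w)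
        (((-(ρ t ∘L A t) - dl t) (x lam t) + ρ t (F₂ t (x lam t))) + l t (x lam t) - ρ τ w)
        (Ici t) t := fun t ht => by
      refine (hder t ⟨ht.1, ht.2.trans_le hlamb.2⟩ _ (hx2 t ht)).sub ?_
      simpa using (((hasDerivAt_id t).sub_const τ).mul_const (ρ τ w)).hasDerivWithinAt
    have h1 := norm_image_sub_le_of_norm_deriv_right_le_segment (C := ε / 2) (b := τ + lam)
      ((hWc.mono (Icc_subset_Icc_right hlamb.2)).sub (by fun_prop)) hW' (fun t ht => ?_)
      (τ + lam) ⟨hlamb.1, le_rfl⟩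
    · simpa [W, hx0] using h1
    · have htm : t ∈ Icc τ b := ⟨ht.1, ht.2.le.trans hlamb.2⟩
      have hpt : p t := hp ⟨by
        rw [Metric.mem_ball, Real.dist_eq, abs_of_nonneg (sub_nonneg.2 ht.1)]
        linarith [ht.2], htm⟩
      have hqt : q (x lam t) := hq _ (by
        rw [mem_ball_zero_iff]; exact (hxC t htm).trans_lt hs3)
      have h1 := (hpq hpt hqt).le
      have h2 : ((-(ρ t ∘L A t) - dl t) (x lam t) + ρ t (F₂ t (x lam t))) + l t (x lam t) - ρ τ w
          = (-(ρ t ∘L A t) - dl t) (x lam t) + (ρ t (F₂ t (x lam t)) - ρ τ w)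
            + l t (x lam t) := by ring
      rw [h2]
      refine (norm_add₃_le).trans ?_
      have h3 := hρ'x t htm
      have h4 := hlx t htm
      have h5 : Q * (C * lam) = (R * K + K) * (C * lam) + (1 + K) * (C * lam) := by
        simp only [Q]; ring
      simp only at h1
      linarith
  have hafter : ‖W b - W (τ + lam)‖ ≤ ε / 2 * lam := by
    have h1 := norm_image_sub_le_of_norm_deriv_right_le_segment
      (C := (R + 1) * (ε₁ * (C * lam))) (a := τ + lam) (b := b) (f := W)
      (hWc.mono (Icc_subset_Icc_left hlamb.1))
      (fun t ht => hder t ⟨hlamb.1.trans ht.1, ht.2⟩ _ (hx1 t ht)) (fun t ht => ?_)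
      b ⟨hlamb.2, le_rfl⟩
    · refine h1.trans ?_
      calc (R + 1) * (ε₁ * (C * lam)) * (b - (τ + lam))
          ≤ (R + 1) * (ε₁ * ((C + 1) * lam)) * (b - τ) := by
            gcongr
            · linarith
            · linarith
            · linarith
        _ = ε / 2 * lam := by
            simp only [ε₁]
            field_simp
    · have htm : t ∈ Icc τ b := ⟨hlamb.1.trans ht.1, ht.2.le⟩
      -- The adjoint equation cancels every linear term, leaving only the two linearization
      -- remainders.
      have h2 : ((-(ρ t ∘L A t) - dl t) (x lam t) + ρ t (F₁ t (x lam t))) + l t (x lam t) =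
          ρ t (F₁ t (x lam t) - A t (x lam t)) + (l t (x lam t) - dl t (x lam t)) := by
        simp only [sub_apply, neg_apply,
          ContinuousLinearMap.comp_apply, map_sub]
        ring
      rw [h2]
      have hx := hxC t htm
      have h3 := (hF₁ t htm _ (hx.trans hsF.le)).trans (mul_le_mul_of_nonneg_left hx hε₁.le)
      have h4 := (hl₁ t htm _ (hx.trans hsl.le)).trans (mul_le_mul_of_nonneg_left hx hε₁.le)
      have h5 := (ρ t).le_of_opNorm_le_of_le (hR t htm) h3
      refine (norm_add_le _ _).trans ?_
      linarith
  have htot := norm_add_le (W b - W (τ + lam)) (W (τ + lam) - lam * ρ τ w)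
  rw [sub_add_sub_cancel] at htot
  rw [Real.norm_of_nonneg hpos.le]
  linarith

namespace LieSwitch

/-! ### Group multiplication in the chart at the identity. -/

section ChartMul

variable (E : Type*) [NormedAddCommGroup E]
  (G : Type*) [TopologicalSpace G] [ChartedSpace E G] [Group G]

/-- The coordinates of the identity in the preferred chart at the identity. -/
noncomputable def chartOne : E := chartAt E (1 : G) 1

/-- The multiplication of the group in the preferred chart at the identity. -/
noncomputable def chartMul (p : E × E) : E :=
  chartAt E (1 : G) ((chartAt E (1 : G)).symm p.1 * (chartAt E (1 : G)).symm p.2)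

/-- The domain of the multiplication in the preferred chart at the identity. -/
def chartMulDomain : Set (E × E) :=
  {p | p ∈ (chartAt E (1 : G)).target ×ˢ (chartAt E (1 : G)).target ∧
    (chartAt E (1 : G)).symm p.1 * (chartAt E (1 : G)).symm p.2 ∈ (chartAt E (1 : G)).source}

variable {E G}

theorem chartOne_mem_target : chartOne E G ∈ (chartAt E (1 : G)).target := mem_chart_target E 1

@[simp]
theorem chart_symm_chartOne : (chartAt E (1 : G)).symm (chartOne E G) = 1 :=
  (chartAt E (1 : G)).left_inv (mem_chart_source E 1)

theorem chartMul_chartOne_left {x : E} (hx : x ∈ (chartAt E (1 : G)).target) :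
    chartMul E G (chartOne E G, x) = x := by
  simp [chartMul, (chartAt E (1 : G)).right_inv hx]

theorem chartMul_chartOne_right {x : E} (hx : x ∈ (chartAt E (1 : G)).target) :
    chartMul E G (x, chartOne E G) = x := by
  simp [chartMul, (chartAt E (1 : G)).right_inv hx]

theorem mem_chartMulDomain_left {x : E} (hx : x ∈ (chartAt E (1 : G)).target) :
    (x, chartOne E G) ∈ chartMulDomain E G := by
  refine ⟨⟨hx, chartOne_mem_target⟩, ?_⟩
  simpa using (chartAt E (1 : G)).map_target hx

theorem mem_chartMulDomain_right {x : E} (hx : x ∈ (chartAt E (1 : G)).target) :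
    (chartOne E G, x) ∈ chartMulDomain E G := by
  refine ⟨⟨chartOne_mem_target, hx⟩, ?_⟩
  simpa using (chartAt E (1 : G)).map_target hx

variable (E G) [NormedSpace ℝ E]

/-- The left-invariant frame in the preferred chart at the identity. -/
noncomputable def leftFrame (x : E) : E →L[ℝ] E :=
  (fderiv ℝ (chartMul E G) (x, chartOne E G)).comp (ContinuousLinearMap.inr ℝ E E)

/-- The right-invariant frame in the preferred chart at the identity. -/
noncomputable def rightFrame (x : E) : E →L[ℝ] E :=
  (fderiv ℝ (chartMul E G) (chartOne E G, x)).comp (ContinuousLinearMap.inl ℝ E E)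

variable {E G}

variable [LieGroup 𝓘(ℝ, E) ∞ G]

theorem isOpen_chartMulDomain : IsOpen (chartMulDomain E G) := by
  have : IsTopologicalGroup G := topologicalGroup_of_lieGroup 𝓘(ℝ, E) ∞
  have hc : ContinuousOn (fun p : E × E => (chartAt E (1 : G)).symm p.1 *
      (chartAt E (1 : G)).symm p.2) ((chartAt E (1 : G)).target ×ˢ (chartAt E (1 : G)).target) :=
    ((chartAt E (1 : G)).continuousOn_symm.comp continuousOn_fst fun p hp => hp.1).mul
      ((chartAt E (1 : G)).continuousOn_symm.comp continuousOn_snd fun p hp => hp.2)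
  exact hc.isOpen_inter_preimage
    ((chartAt E (1 : G)).open_target.prod (chartAt E (1 : G)).open_target)
    (chartAt E (1 : G)).open_source

theorem contDiffOn_chartMul : ContDiffOn ℝ ∞ (chartMul E G) (chartMulDomain E G) := by
  rw [← contMDiffOn_iff_contDiffOn]
  have h1 : ContMDiffOn 𝓘(ℝ, E) 𝓘(ℝ, E) ∞ (chartAt E (1 : G)).symm (chartAt E (1 : G)).target :=
    contMDiffOn_chart_symm
  have h2 : ContMDiffOn 𝓘(ℝ, E) 𝓘(ℝ, E) ∞ (chartAt E (1 : G)) (chartAt E (1 : G)).source :=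
    contMDiffOn_chart
  have hf : ContMDiffOn 𝓘(ℝ, E × E) 𝓘(ℝ, E) ∞ (Prod.fst : E × E → E) (chartMulDomain E G) :=
    contDiff_fst.contMDiff.contMDiffOn
  have hs : ContMDiffOn 𝓘(ℝ, E × E) 𝓘(ℝ, E) ∞ (Prod.snd : E × E → E) (chartMulDomain E G) :=
    contDiff_snd.contMDiff.contMDiffOn
  exact h2.comp ((h1.comp hf fun p hp => hp.1.1).mul (h1.comp hs fun p hp => hp.1.2))
    fun p hp => hp.2

theorem differentiableAt_chartMul {p : E × E} (hp : p ∈ chartMulDomain E G) :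
    DifferentiableAt ℝ (chartMul E G) p :=
  (contDiffOn_chartMul.contDiffAt (isOpen_chartMulDomain.mem_nhds hp)).differentiableAt (by simp)

theorem contDiffOn_fderiv_chartMul :
    ContDiffOn ℝ ∞ (fderiv ℝ (chartMul E G)) (chartMulDomain E G) :=
  contDiffOn_chartMul.fderiv_of_isOpen isOpen_chartMulDomain (by simp)

theorem contDiffOn_leftFrame : ContDiffOn ℝ ∞ (leftFrame E G) (chartAt E (1 : G)).target := by
  have h : ContDiffOn ℝ ∞ (fun x => fderiv ℝ (chartMul E G) (x, chartOne E G))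
      (chartAt E (1 : G)).target :=
    contDiffOn_fderiv_chartMul.comp (contDiff_id.prodMk contDiff_const).contDiffOn
      fun x hx => mem_chartMulDomain_left hx
  exact h.clm_comp contDiffOn_const

theorem contDiffOn_rightFrame : ContDiffOn ℝ ∞ (rightFrame E G) (chartAt E (1 : G)).target := by
  have h : ContDiffOn ℝ ∞ (fun x => fderiv ℝ (chartMul E G) (chartOne E G, x))
      (chartAt E (1 : G)).target :=
    contDiffOn_fderiv_chartMul.comp (contDiff_const.prodMk contDiff_id).contDiffOn
      fun x hx => mem_chartMulDomain_right hx
  exact h.clm_comp contDiffOn_const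

theorem fderiv_chartMul_inr {x : E} (hx : x ∈ (chartAt E (1 : G)).target) (v : E) :
    fderiv ℝ (chartMul E G) (chartOne E G, x) (0, v) = v := by
  have h1 : HasFDerivAt (fun y : E => chartMul E G (chartOne E G, y))
      ((fderiv ℝ (chartMul E G) (chartOne E G, x)).comp (ContinuousLinearMap.inr ℝ E E)) x :=
    (differentiableAt_chartMul (mem_chartMulDomain_right hx)).hasFDerivAt.comp x
      (hasFDerivAt_prodMk_right _ x)
  have h2 : HasFDerivAt (fun y : E => chartMul E G (chartOne E G, y))
      (ContinuousLinearMap.id ℝ E) x :=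
    (hasFDerivAt_id x).congr_of_eventuallyEq (mem_of_superset
      ((chartAt E (1 : G)).open_target.mem_nhds hx) fun y hy => chartMul_chartOne_left hy)
  simpa using DFunLike.congr_fun (h1.unique h2) v

theorem fderiv_chartMul_inl {x : E} (hx : x ∈ (chartAt E (1 : G)).target) (v : E) :
    fderiv ℝ (chartMul E G) (x, chartOne E G) (v, 0) = v := by
  have h1 : HasFDerivAt (fun y : E => chartMul E G (y, chartOne E G))
      ((fderiv ℝ (chartMul E G) (x, chartOne E G)).comp (ContinuousLinearMap.inl ℝ E E)) x :=
    HasFDerivAt.comp (g := chartMul E G) (f := fun y : E => (y, chartOne E G)) x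
      (differentiableAt_chartMul (mem_chartMulDomain_left hx)).hasFDerivAt
      (hasFDerivAt_prodMk_left x _)
  have h2 : HasFDerivAt (fun y : E => chartMul E G (y, chartOne E G))
      (ContinuousLinearMap.id ℝ E) x :=
    (hasFDerivAt_id x).congr_of_eventuallyEq (mem_of_superset
      ((chartAt E (1 : G)).open_target.mem_nhds hx) fun y hy => chartMul_chartOne_right hy)
  simpa using DFunLike.congr_fun (h1.unique h2) v

theorem leftFrame_chartOne (v : E) : leftFrame E G (chartOne E G) v = v :=
  fderiv_chartMul_inr chartOne_mem_target v

theorem rightFrame_chartOne (v : E) : rightFrame E G (chartOne E G) v = v :=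
  fderiv_chartMul_inl chartOne_mem_target v

theorem differentiableAt_leftFrame {x : E} (hx : x ∈ (chartAt E (1 : G)).target) :
    DifferentiableAt ℝ (leftFrame E G) x :=
  (contDiffOn_leftFrame.contDiffAt
    ((chartAt E (1 : G)).open_target.mem_nhds hx)).differentiableAt (by simp)

theorem differentiableAt_rightFrame {x : E} (hx : x ∈ (chartAt E (1 : G)).target) :
    DifferentiableAt ℝ (rightFrame E G) x :=
  (contDiffOn_rightFrame.contDiffAt
    ((chartAt E (1 : G)).open_target.mem_nhds hx)).differentiableAt (by simp)

/-- Both sides are the mixed second derivative of the multiplication at `(e, e)`, taken in the two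
possible orders, so symmetry of second derivatives applies. -/
theorem fderiv_rightFrame_chartOne (v w : E) :
    fderiv ℝ (rightFrame E G) (chartOne E G) v w =
      fderiv ℝ (leftFrame E G) (chartOne E G) w v := by
  have hmem := mem_chartMulDomain_left (G := G) (chartOne_mem_target (E := E))
  have hC := contDiffOn_chartMul.contDiffAt (isOpen_chartMulDomain.mem_nhds hmem)
  have hD : HasFDerivAt (fderiv ℝ (chartMul E G))
      (fderiv ℝ (fderiv ℝ (chartMul E G)) (chartOne E G, chartOne E G))
      (chartOne E G, chartOne E G) :=
    ((contDiffOn_fderiv_chartMul.contDiffAt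
      (isOpen_chartMulDomain.mem_nhds hmem)).differentiableAt (by simp)).hasFDerivAt
  have hsymm := (hC.isSymmSndFDerivAt (by
    rw [minSmoothness_of_isRCLikeNormedField]; exact WithTop.coe_le_coe.2 le_top)).eq
      (0, v) (w, 0)
  have hl : HasFDerivAt (leftFrame E G) _ (chartOne E G) :=
    (HasFDerivAt.comp (g := fderiv ℝ (chartMul E G)) (f := fun y : E => (y, chartOne E G))
      (chartOne E G) hD (hasFDerivAt_prodMk_left _ _)).clm_comp (hasFDerivAt_const (ContinuousLinearMap.inr ℝ E E) (chartOne E G))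
  have hr : HasFDerivAt (rightFrame E G) _ (chartOne E G) :=
    (HasFDerivAt.comp (g := fderiv ℝ (chartMul E G)) (f := fun y : E => (chartOne E G, y))
      (chartOne E G) hD (hasFDerivAt_prodMk_right _ _)).clm_comp (hasFDerivAt_const (ContinuousLinearMap.inl ℝ E E) (chartOne E G))
  rw [hl.fderiv, hr.fderiv]
  simpa using hsymm

end ChartMul

/-! ### The Lie bracket as the antisymmetrized second derivative of the multiplication. -/

section Bracket

variable {E : Type*} [NormedAddCommGroup E] [NormedSpace ℝ E]
  {G : Type*} [TopologicalSpace G] [ChartedSpace E G] [Group G] [LieGroup 𝓘(ℝ, E) ∞ G]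

theorem hasMFDerivAt_mul_left (q g : G) :
    HasMFDerivAt 𝓘(ℝ, E) 𝓘(ℝ, E) (fun y : G => q * y) g
      (mfderiv 𝓘(ℝ, E) 𝓘(ℝ, E) (fun y : G => q * y) g) :=
  ((contMDiff_mul_left (I := 𝓘(ℝ, E)) (n := ∞) (a := q)).mdifferentiable
    (by simp)).mdifferentiableAt.hasMFDerivAt

theorem hasMFDerivAt_chart_one :
    HasMFDerivAt 𝓘(ℝ, E) 𝓘(ℝ, E) (chartAt E (1 : G)) 1 (ContinuousLinearMap.id ℝ E) := by
  have : IsManifold 𝓘(ℝ, E) 1 G := IsManifold.of_le (n := ∞) (mod_cast le_top)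
  have h := (mdifferentiableAt_extChartAt (I := 𝓘(ℝ, E)) (mem_chart_source E (1 : G))).hasMFDerivAt
  rw [mfderiv_extChartAt_self] at h
  simpa using! h

theorem hasMFDerivAt_chart_symm_chartOne :
    HasMFDerivAt 𝓘(ℝ, E) 𝓘(ℝ, E) (chartAt E (1 : G)).symm (chartOne E G)
      (ContinuousLinearMap.id ℝ E) := by
  have : IsManifold 𝓘(ℝ, E) 1 G := IsManifold.of_le (n := ∞) (mod_cast le_top)
  have h := (mdifferentiableWithinAt_extChartAt_symm (I := 𝓘(ℝ, E))
    (mem_extChartAt_target (I := 𝓘(ℝ, E)) (1 : G))).hasMFDerivWithinAt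
  rw [mfderivWithin_range_extChartAt_symm] at h
  have h' : HasMFDerivWithinAt 𝓘(ℝ, E) 𝓘(ℝ, E) (chartAt E (1 : G)).symm univ (chartOne E G)
      (ContinuousLinearMap.id ℝ E) := by
    simpa [chartOne] using! h
  exact hasMFDerivWithinAt_univ.1 h'

/-- In the preferred chart at the identity, left-invariant vector fields are given by the
left-invariant frame. -/
theorem mfderiv_chart_mulInvariantVectorField {g : G} (hg : g ∈ (chartAt E (1 : G)).source)
    (v : E) :
    (mfderiv 𝓘(ℝ, E) 𝓘(ℝ, E) (chartAt E (1 : G)) g : E →L[ℝ] E)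
      (mulInvariantVectorField (I := 𝓘(ℝ, E)) (v : GroupLieAlgebra 𝓘(ℝ, E) G) g) =
      leftFrame E G (chartAt E (1 : G) g) v := by
  have : IsManifold 𝓘(ℝ, E) 1 G := IsManifold.of_le (n := ∞) (mod_cast le_top)
  have hx := (chartAt E (1 : G)).map_source hg
  have h1 : HasFDerivAt (fun y : E => chartMul E G (chartAt E (1 : G) g, y))
      (leftFrame E G (chartAt E (1 : G) g)) (chartOne E G) :=
    (differentiableAt_chartMul (mem_chartMulDomain_left hx)).hasFDerivAt.comp (chartOne E G)
      (hasFDerivAt_prodMk_right _ _)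
  have h2 : HasMFDerivAt 𝓘(ℝ, E) 𝓘(ℝ, E) (chartAt E (1 : G)) g
      (mfderiv 𝓘(ℝ, E) 𝓘(ℝ, E) (chartAt E (1 : G)) g) :=
    (mdifferentiableAt_atlas (chart_mem_atlas E (1 : G)) hg).hasMFDerivAt
  have h3 : HasMFDerivAt 𝓘(ℝ, E) 𝓘(ℝ, E) (fun y : G => chartAt E (1 : G) (g * y)) 1
      ((mfderiv 𝓘(ℝ, E) 𝓘(ℝ, E) (chartAt E (1 : G)) g : E →L[ℝ] E).comp
        (mfderiv 𝓘(ℝ, E) 𝓘(ℝ, E) (fun y : G => g * y) 1 : E →L[ℝ] E)) :=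
    HasMFDerivAt.comp (g := chartAt E (1 : G)) 1 (by rw [mul_one]; exact h2)
      (hasMFDerivAt_mul_left g 1)
  have h4 : HasMFDerivAt 𝓘(ℝ, E) 𝓘(ℝ, E)
      (fun y : E => chartAt E (1 : G) (g * (chartAt E (1 : G)).symm y)) (chartOne E G)
      (((mfderiv 𝓘(ℝ, E) 𝓘(ℝ, E) (chartAt E (1 : G)) g : E →L[ℝ] E).comp
        (mfderiv 𝓘(ℝ, E) 𝓘(ℝ, E) (fun y : G => g * y) 1 : E →L[ℝ] E)).comp
          (ContinuousLinearMap.id ℝ E)) :=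
    HasMFDerivAt.comp (g := fun y : G => chartAt E (1 : G) (g * y)) (chartOne E G)
      (by rw [chart_symm_chartOne]; exact h3) hasMFDerivAt_chart_symm_chartOne
  -- The same map has been differentiated in coordinates and intrinsically; uniqueness of the
  -- derivative compares the results.
  have h5 : (fun y : E => chartMul E G (chartAt E (1 : G) g, y)) =
      fun y : E => chartAt E (1 : G) (g * (chartAt E (1 : G)).symm y) := by
    funext y; simp [chartMul, (chartAt E (1 : G)).left_inv hg]
  rw [h5] at h1
  let A : E →L[ℝ] E := mfderiv 𝓘(ℝ, E) 𝓘(ℝ, E) (chartAt E (1 : G)) g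
  let B : E →L[ℝ] E := mfderiv 𝓘(ℝ, E) 𝓘(ℝ, E) (fun y : G => g * y) 1
  have h6 : HasFDerivAt (fun y : E => chartAt E (1 : G) (g * (chartAt E (1 : G)).symm y))
      (A.comp B) (chartOne E G) := h4.hasFDerivAt
  exact congrArg (fun T : E →L[ℝ] E => T v) (h6.unique h1)

/-- At `e` the frame is the identity, so the values of the fields there are `v` and `w`, and only
the derivative of the frame remains in the coordinate bracket. -/
theorem lieBracketWithin_leftFrame {V W : E → E} (v w : E)
    (hV : V =ᶠ[𝓝 (chartOne E G)] fun x => leftFrame E G x v)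
    (hW : W =ᶠ[𝓝 (chartOne E G)] fun x => leftFrame E G x w) :
    VectorField.lieBracketWithin ℝ V W univ (chartOne E G) =
      fderiv ℝ (leftFrame E G) (chartOne E G) v w -
        fderiv ℝ (leftFrame E G) (chartOne E G) w v := by
  have hl : ∀ u : E, HasFDerivAt (fun x => leftFrame E G x u)
      ((fderiv ℝ (leftFrame E G) (chartOne E G)).flip u) (chartOne E G) := fun u => by
    have h := (differentiableAt_leftFrame
      (chartOne_mem_target (E := E) (G := G))).hasFDerivAt.clm_apply
        (hasFDerivAt_const u (chartOne E G))
    simpa using h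
  rw [VectorField.lieBracketWithin_univ, hV.lieBracket_vectorField_eq hW, VectorField.lieBracket,
    (hl v).fderiv, (hl w).fderiv]
  simp only [ContinuousLinearMap.flip_apply, leftFrame_chartOne]

theorem bracket_eq_fderiv_leftFrame (v w : GroupLieAlgebra 𝓘(ℝ, E) G) :
    ⁅v, w⁆ = (fderiv ℝ (leftFrame E G) (chartOne E G) (v : E) (w : E) -
        fderiv ℝ (leftFrame E G) (chartOne E G) (w : E) (v : E) : E) := by
  have : IsManifold 𝓘(ℝ, E) 1 G := IsManifold.of_le (n := ∞) (mod_cast le_top)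
  -- The manifold bracket is computed from the fields pulled back to the chart; near `e` these are
  -- the columns of the left-invariant frame.
  have key : ∀ u : E, (VectorField.mpullbackWithin 𝓘(ℝ, E) 𝓘(ℝ, E)
      (extChartAt 𝓘(ℝ, E) (1 : G)).symm
      (mulInvariantVectorField (I := 𝓘(ℝ, E)) (u : GroupLieAlgebra 𝓘(ℝ, E) G))
      (range 𝓘(ℝ, E)) : E → E) =ᶠ[𝓝 (chartOne E G)] fun x => leftFrame E G x u := by
    intro u
    filter_upwards [(chartAt E (1 : G)).open_target.mem_nhds chartOne_mem_target] with x hx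
    have hg := (chartAt E (1 : G)).map_target hx
    have hx' : x ∈ (extChartAt 𝓘(ℝ, E) (1 : G)).target := by simpa using hx
    have h1 := mfderiv_chart_mulInvariantVectorField hg u
    rw [(chartAt E (1 : G)).right_inv hx] at h1
    rw [← h1, VectorField.mpullbackWithin_apply]
    have hinv := ContinuousLinearMap.inverse_eq
      (mfderivWithin_extChartAt_symm_comp_mfderiv_extChartAt hx')
      (mfderiv_extChartAt_comp_mfderivWithin_extChartAt_symm hx')
    rw [hinv]
    simp
    rfl
  rw [GroupLieAlgebra.bracket_def, VectorField.mlieBracket, VectorField.mlieBracketWithin_apply,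
    mfderiv_extChartAt_self]
  have hset : (extChartAt 𝓘(ℝ, E) (1 : G)).symm ⁻¹' univ ∩ range 𝓘(ℝ, E) = univ := by simp
  have hpt : extChartAt 𝓘(ℝ, E) (1 : G) 1 = chartOne E G := by simp [chartOne]
  rw [hset, hpt]
  have h := lieBracketWithin_leftFrame (E := E) (G := G) v w (key v) (key w)
  exact (congrArg (fun A : E →L[ℝ] E => A _) ContinuousLinearMap.inverse_id).trans h

end Bracket

/-! ### Logarithmic derivatives and the equation of relative motion. -/

section Curves

variable {E : Type*} [NormedAddCommGroup E] [NormedSpace ℝ E]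
  {G : Type*} [TopologicalSpace G] [ChartedSpace E G] [Group G]

theorem mulInvariantVectorField_one (η : GroupLieAlgebra 𝓘(ℝ, E) G) :
    mulInvariantVectorField (I := 𝓘(ℝ, E)) η (1 : G) = η := by
  have h : (fun y : G => 1 * y) = id := by funext y; simp
  have h2 : mfderiv 𝓘(ℝ, E) 𝓘(ℝ, E) (fun y : G => 1 * y) 1 = ContinuousLinearMap.id ℝ E := by
    rw [h]; exact mfderiv_id
  exact congrArg (fun A : E →L[ℝ] E => A η) h2

variable [LieGroup 𝓘(ℝ, E) ∞ G]

theorem mfderiv_mul_left_mulInvariantVectorField (x q : G) (η : GroupLieAlgebra 𝓘(ℝ, E) G) :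
    mfderiv 𝓘(ℝ, E) 𝓘(ℝ, E) (fun y : G => x * y) q
      (mulInvariantVectorField (I := 𝓘(ℝ, E)) η q) =
      mulInvariantVectorField (I := 𝓘(ℝ, E)) η (x * q) := by
  have h2 : HasMFDerivAt 𝓘(ℝ, E) 𝓘(ℝ, E) (fun y : G => x * y) (q * 1)
      (mfderiv 𝓘(ℝ, E) 𝓘(ℝ, E) (fun y : G => x * y) q : E →L[ℝ] E) := by
    rw [mul_one]; exact hasMFDerivAt_mul_left x q
  have hmul : (fun y : G => x * q * y) = (fun y : G => x * y) ∘ (fun y : G => q * y) := by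
    funext y; simp [mul_assoc]
  have h12 := (h2.comp 1 (hasMFDerivAt_mul_left q 1)).mfderiv
  rw [← hmul] at h12
  exact (congrArg (fun A : E →L[ℝ] E => A η) h12).symm

/-- The left logarithmic derivative of a curve, read in the preferred chart at the identity. -/
theorem hasDerivWithinAt_chart_inv_mul {c : ℝ → G} {ξ : E} {s : Set ℝ} {t : ℝ}
    (hc : HasMFDerivWithinAt 𝓘(ℝ, ℝ) 𝓘(ℝ, E) c s t ((1 : ℝ →L[ℝ] ℝ).smulRight
      (mulInvariantVectorField (I := 𝓘(ℝ, E)) (ξ : GroupLieAlgebra 𝓘(ℝ, E) G) (c t)))) :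
    HasDerivWithinAt (fun u => chartAt E (1 : G) ((c t)⁻¹ * c u)) ξ s t := by
  let A : E →L[ℝ] E := mfderiv 𝓘(ℝ, E) 𝓘(ℝ, E) (fun y : G => (c t)⁻¹ * y) (c t)
  let η : E := mulInvariantVectorField (I := 𝓘(ℝ, E)) (ξ : GroupLieAlgebra 𝓘(ℝ, E) G) (c t)
  have hA : A η = ξ := by
    have h1 : ∀ g : G, g = 1 → (mulInvariantVectorField (I := 𝓘(ℝ, E))
        (ξ : GroupLieAlgebra 𝓘(ℝ, E) G) g : E) = ξ := by
      rintro _ rfl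
      exact mulInvariantVectorField_one (G := G) ξ
    exact (mfderiv_mul_left_mulInvariantVectorField (c t)⁻¹ (c t)
      (ξ : GroupLieAlgebra 𝓘(ℝ, E) G)).trans (h1 _ (inv_mul_cancel _))
  have h1 : HasMFDerivWithinAt 𝓘(ℝ, ℝ) 𝓘(ℝ, E) (fun u => (c t)⁻¹ * c u) s t
      (A.comp ((1 : ℝ →L[ℝ] ℝ).smulRight η)) :=
    (hasMFDerivAt_mul_left (c t)⁻¹ (c t)).comp_hasMFDerivWithinAt t hc
  have h2 : HasMFDerivAt 𝓘(ℝ, E) 𝓘(ℝ, E) (chartAt E (1 : G)) ((c t)⁻¹ * c t)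
      (ContinuousLinearMap.id ℝ E) := by
    rw [inv_mul_cancel]; exact hasMFDerivAt_chart_one
  have h3 : HasMFDerivWithinAt 𝓘(ℝ, ℝ) 𝓘(ℝ, E) (fun u => chartAt E (1 : G) ((c t)⁻¹ * c u)) s t
      ((ContinuousLinearMap.id ℝ E).comp (A.comp ((1 : ℝ →L[ℝ] ℝ).smulRight η))) :=
    h2.comp_hasMFDerivWithinAt t h1
  have h4 : HasFDerivWithinAt (fun u => chartAt E (1 : G) ((c t)⁻¹ * c u))
      ((ContinuousLinearMap.id ℝ E).comp (A.comp ((1 : ℝ →L[ℝ] ℝ).smulRight η))) s t :=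
    h3.hasFDerivWithinAt
  have h5 := h4.hasDerivWithinAt
  simpa [hA] using h5

/-- The quotient `c₁⁻¹ c₂` of two curves with left logarithmic derivatives `ξ₁`, `ξ₂` satisfies
`ẋ = ℓ(x) ξ₂ - r(x) ξ₁` in the preferred chart at the identity, where `ℓ` and `r` are the left-
and right-invariant frames. -/
theorem hasDerivWithinAt_chart_inv_mul_curves {c₁ c₂ : ℝ → G} {ξ₁ ξ₂ : E} {s : Set ℝ} {t : ℝ}
    (hs : UniqueDiffWithinAt ℝ s t) (hts : t ∈ s)
    (hc₁ : HasMFDerivWithinAt 𝓘(ℝ, ℝ) 𝓘(ℝ, E) c₁ s t ((1 : ℝ →L[ℝ] ℝ).smulRight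
      (mulInvariantVectorField (I := 𝓘(ℝ, E)) (ξ₁ : GroupLieAlgebra 𝓘(ℝ, E) G) (c₁ t))))
    (hc₂ : HasMFDerivWithinAt 𝓘(ℝ, ℝ) 𝓘(ℝ, E) c₂ s t ((1 : ℝ →L[ℝ] ℝ).smulRight
      (mulInvariantVectorField (I := 𝓘(ℝ, E)) (ξ₂ : GroupLieAlgebra 𝓘(ℝ, E) G) (c₂ t))))
    (hmem : (c₁ t)⁻¹ * c₂ t ∈ (chartAt E (1 : G)).source) :
    HasDerivWithinAt (fun u => chartAt E (1 : G) ((c₁ u)⁻¹ * c₂ u))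
      (leftFrame E G (chartAt E (1 : G) ((c₁ t)⁻¹ * c₂ t)) ξ₂ -
        rightFrame E G (chartAt E (1 : G) ((c₁ t)⁻¹ * c₂ t)) ξ₁) s t := by
  have : IsTopologicalGroup G := topologicalGroup_of_lieGroup 𝓘(ℝ, E) ∞
  have : IsManifold 𝓘(ℝ, E) 1 G := IsManifold.of_le (n := ∞) (mod_cast le_top)
  set χ := chartAt E (1 : G) with hχ
  set h : ℝ → G := fun u => (c₁ u)⁻¹ * c₂ u with hh
  have hm₁ : MDifferentiableWithinAt 𝓘(ℝ, ℝ) 𝓘(ℝ, E) c₁ s t := hc₁.mdifferentiableWithinAt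
  have hm₂ : MDifferentiableWithinAt 𝓘(ℝ, ℝ) 𝓘(ℝ, E) c₂ s t := hc₂.mdifferentiableWithinAt
  have hcont : ContinuousWithinAt h s t :=
    hm₁.continuousWithinAt.inv.mul hm₂.continuousWithinAt
  have hdiff : DifferentiableWithinAt ℝ (fun u => χ (h u)) s t := by
    have h1 : MDifferentiableAt (𝓘(ℝ, E).prod 𝓘(ℝ, E)) 𝓘(ℝ, E) (fun p : G × G => p.1⁻¹ * p.2)
        (c₁ t, c₂ t) :=
      ((contMDiff_fst.inv.mul contMDiff_snd : ContMDiff (𝓘(ℝ, E).prod 𝓘(ℝ, E)) 𝓘(ℝ, E) ∞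
        (fun p : G × G => p.1⁻¹ * p.2)).mdifferentiable (by simp)) _
    have h2 : MDifferentiableWithinAt 𝓘(ℝ, ℝ) 𝓘(ℝ, E) h s t :=
      h1.comp_mdifferentiableWithinAt t (hm₁.prodMk hm₂)
    have h3 : MDifferentiableAt 𝓘(ℝ, E) 𝓘(ℝ, E) χ (h t) :=
      mdifferentiableAt_atlas (chart_mem_atlas E (1 : G)) hmem
    exact (h3.comp_mdifferentiableWithinAt t h2).differentiableWithinAt
  obtain ⟨v, hv⟩ : ∃ v, HasDerivWithinAt (fun u => χ (h u)) v s t :=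
    ⟨_, hdiff.hasDerivWithinAt⟩
  have hα := hasDerivWithinAt_chart_inv_mul hc₁
  have hβ := hasDerivWithinAt_chart_inv_mul hc₂
  have hx : χ (h t) ∈ χ.target := χ.map_source hmem
  -- The equation comes from differentiating at `u = t` the identity `(c₁(t)⁻¹ c₁(u)) (c₁(u)⁻¹
  -- c₂(u)) = (c₁(t)⁻¹ c₂(t)) (c₂(t)⁻¹ c₂(u))`. Each side is a product in which one factor equals
  -- the identity at `u = t`, and no derivative of the inversion has to be computed.
  have hL : HasDerivWithinAt (fun u => chartMul E G (χ ((c₁ t)⁻¹ * c₁ u), χ (h u)))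
      (fderiv ℝ (chartMul E G) (chartOne E G, χ (h t)) (ξ₁, v)) s t := by
    have hp : HasFDerivAt (chartMul E G) (fderiv ℝ (chartMul E G) (chartOne E G, χ (h t)))
        (χ ((c₁ t)⁻¹ * c₁ t), χ (h t)) := by
      rw [inv_mul_cancel]
      exact (differentiableAt_chartMul (mem_chartMulDomain_right hx)).hasFDerivAt
    exact HasFDerivAt.comp_hasDerivWithinAt (l := chartMul E G)
      (f := fun u => (χ ((c₁ t)⁻¹ * c₁ u), χ (h u))) t hp (hα.prodMk hv)
  have hR : HasDerivWithinAt (fun u => chartMul E G (χ (h t), χ ((c₂ t)⁻¹ * c₂ u)))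
      (fderiv ℝ (chartMul E G) (χ (h t), chartOne E G) (0, ξ₂)) s t := by
    have hp : HasFDerivAt (chartMul E G) (fderiv ℝ (chartMul E G) (χ (h t), chartOne E G))
        (χ (h t), χ ((c₂ t)⁻¹ * c₂ t)) := by
      rw [inv_mul_cancel]
      exact (differentiableAt_chartMul (mem_chartMulDomain_left hx)).hasFDerivAt
    exact HasFDerivAt.comp_hasDerivWithinAt (l := chartMul E G)
      (f := fun u => (χ (h t), χ ((c₂ t)⁻¹ * c₂ u))) t hp
      ((hasDerivWithinAt_const t s (χ (h t))).prodMk hβ)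
  have hsrc : ∀ {c : ℝ → G} (_ : ContinuousWithinAt c s t),
      ∀ᶠ u in 𝓝[s] t, (c t)⁻¹ * c u ∈ χ.source := fun {c} hc => by
    refine (hc.const_mul (c t)⁻¹ : ContinuousWithinAt (fun u => (c t)⁻¹ * c u) s t)
      (χ.open_source.mem_nhds ?_)
    simp [χ]
  have heq : (fun u => chartMul E G (χ ((c₁ t)⁻¹ * c₁ u), χ (h u))) =ᶠ[𝓝[s] t]
      fun u => chartMul E G (χ (h t), χ ((c₂ t)⁻¹ * c₂ u)) := by
    filter_upwards [hsrc hm₁.continuousWithinAt, hsrc hm₂.continuousWithinAt,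
      hcont (χ.open_source.mem_nhds hmem)] with u h1 h2 h3
    simp only [chartMul]
    rw [← hχ, χ.left_inv h1, χ.left_inv h2, χ.left_inv h3, χ.left_inv hmem]
    simp only [hh]
    congr 1
    group
  have huniq := hs.eq_deriv _ hL (hR.congr_of_eventuallyEq_of_mem heq hts)
  have hsplit : ((ξ₁, v) : E × E) = (ξ₁, 0) + (0, v) := by simp
  rw [hsplit, map_add, fderiv_chartMul_inr hx] at huniq
  have hvv : v = leftFrame E G (χ (h t)) ξ₂ - rightFrame E G (χ (h t)) ξ₁ := by
    simp only [leftFrame, rightFrame, ContinuousLinearMap.comp_apply, ContinuousLinearMap.inl_apply,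
      ContinuousLinearMap.inr_apply]
    rw [← huniq]; abel
  rw [← hvv]
  exact hv

end Curves

/-! ### The left-trivialized derivative in the chart. -/

section LeftDeriv

variable {E : Type*} [NormedAddCommGroup E] [NormedSpace ℝ E] [FiniteDimensional ℝ E]
  {G : Type*} [TopologicalSpace G] [ChartedSpace E G] [Group G] [LieGroup 𝓘(ℝ, E) ∞ G]
  [T2Space G]

/-- The one-parameter subgroup generated by `η`. -/
theorem exists_oneParameter (η : GroupLieAlgebra 𝓘(ℝ, E) G) :
    ∃ c : ℝ → G, Continuous c ∧ c 0 = 1 ∧ (∀ s : ℝ, lieExp (s • η) = c s) ∧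
      HasDerivAt (fun s => chartAt E (1 : G) (c s)) (η : E) 0 := by
  obtain ⟨c, h0, hc⟩ := exists_integralCurve η
  refine ⟨c, hc.continuous, h0, fun s => ?_, ?_⟩
  -- Rescaling time by `s` turns the integral curve of `η` into that of `s • η`, whose time-one
  -- value is `c s`.
  · have h1 := hc.comp_mul s
    rw [← mulInvariantVectorField_smul] at h1
    rw [lieExp_eq _ (c ∘ (· * s)) (by simp [h0]) h1]
    simp
  · have h := hasDerivWithinAt_chart_inv_mul (G := G) (E := E) (ξ := η) (s := univ)
      (hc 0).hasMFDerivWithinAt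
    have h' : HasDerivWithinAt (fun s => chartAt E (1 : G) (c s)) (η : E) univ 0 := by
      simpa [h0] using! h
    exact hasDerivWithinAt_univ.1 h'

/-- The left-trivialized derivative in the preferred chart at the identity. -/
theorem leftDeriv_eq_of_hasFDerivAt {V : Type*} [NormedAddCommGroup V] [NormedSpace ℝ V]
    {f : G → V} {g : G} {f' : E →L[ℝ] V}
    (hf : HasFDerivAt (fun x : E => f (g * (chartAt E (1 : G)).symm x)) f' (chartOne E G))
    (η : GroupLieAlgebra 𝓘(ℝ, E) G) : leftDeriv f g η = f' (η : E) := by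
  obtain ⟨c, hcont, h0, hexp, hd⟩ := exists_oneParameter η
  rw [leftDeriv]
  simp only [hexp]
  have hf' : HasFDerivAt (fun x : E => f (g * (chartAt E (1 : G)).symm x)) f'
      (chartAt E (1 : G) (c 0)) := by rw [h0]; exact hf
  have h1 := HasFDerivAt.comp_hasDerivAt (l := fun x : E => f (g * (chartAt E (1 : G)).symm x))
    (f := fun s => chartAt E (1 : G) (c s)) 0 hf' hd
  refine HasDerivAt.deriv (h1.congr_of_eventuallyEq ?_)
  have hsrc : ∀ᶠ s in 𝓝 (0 : ℝ), c s ∈ (chartAt E (1 : G)).source :=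
    hcont.continuousAt ((chartAt E (1 : G)).open_source.mem_nhds (by
      rw [h0]; exact mem_chart_source E 1))
  filter_upwards [hsrc] with s hs
  simp [(chartAt E (1 : G)).left_inv hs]

end LeftDeriv

end LieSwitch

/-- A curve of linear forms on a finite-dimensional space is differentiable if its evaluations
are. -/
theorem hasDerivWithinAt_dual_of_forall_apply {X : Type*} [NormedAddCommGroup X] [NormedSpace ℝ X]
    [FiniteDimensional ℝ X] {u : ℝ → X →L[ℝ] ℝ} {u' : X →L[ℝ] ℝ} {s : Set ℝ} {t : ℝ}
    (h : ∀ v, HasDerivWithinAt (fun r => u r v) (u' v) s t) : HasDerivWithinAt u u' s t := by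
  set b := Module.finBasis ℝ X
  -- Expansion in the dual basis reduces the claim to finitely many scalar derivatives.
  have hb : ∀ T : X →L[ℝ] ℝ, T = ∑ i, T (b i) • (b.coord i).toContinuousLinearMap := fun T => by
    ext v
    calc T v = T (∑ i, b.repr v i • b i) := by rw [b.sum_repr]
      _ = _ := by rw [map_sum]; simp [mul_comm]
  have h1 : HasDerivWithinAt (fun r => ∑ i, u r (b i) • (b.coord i).toContinuousLinearMap)
      (∑ i, u' (b i) • (b.coord i).toContinuousLinearMap) s t :=
    HasDerivWithinAt.fun_sum fun i _ =>
      HasDerivWithinAt.smul_const (F := X →L[ℝ] ℝ) (h (b i)) (b.coord i).toContinuousLinearMap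
  rw [← hb u'] at h1
  exact h1.congr (fun r _ => hb (u r)) (hb (u t))

namespace LieSwitch

/-! ### Regularity of functions translated along a curve. -/

section Translate

variable {E : Type*} [NormedAddCommGroup E] [NormedSpace ℝ E]
  {G : Type*} [TopologicalSpace G] [ChartedSpace E G] [Group G] [LieGroup 𝓘(ℝ, E) ∞ G]
  {V : Type*} [NormedAddCommGroup V] [NormedSpace ℝ V] {S : Set ℝ} {f : G → ℝ → V} {c : ℝ → G}

theorem continuousOn_translate
    (hf : ContMDiffOn (𝓘(ℝ, E).prod 𝓘(ℝ, ℝ)) 𝓘(ℝ, V) 1 (fun p : G × ℝ => f p.1 p.2)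
      (univ ×ˢ S)) (hc : ContinuousOn c S) :
    ContinuousOn (fun p : ℝ × E => f (c p.1 * (chartAt E (1 : G)).symm p.2) p.1)
      (S ×ˢ (chartAt E (1 : G)).target) := by
  have : IsTopologicalGroup G := topologicalGroup_of_lieGroup 𝓘(ℝ, E) ∞
  have h1 : ContinuousOn (fun p : ℝ × E => (c p.1 * (chartAt E (1 : G)).symm p.2, p.1))
      (S ×ˢ (chartAt E (1 : G)).target) :=
    ((hc.comp continuousOn_fst fun p hp => hp.1).mul
      ((chartAt E (1 : G)).continuousOn_symm.comp continuousOn_snd fun p hp => hp.2)).prodMk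
        continuousOn_fst
  exact hf.continuousOn.comp h1 fun p hp => ⟨mem_univ _, hp.1⟩

/-- The group element is kept as a free variable because `c` is only continuous: `C¹` regularity
holds before substituting `c`, continuity survives the substitution. -/
theorem contMDiffOn_translate
    (hf : ContMDiffOn (𝓘(ℝ, E).prod 𝓘(ℝ, ℝ)) 𝓘(ℝ, V) 1 (fun p : G × ℝ => f p.1 p.2)
      (univ ×ˢ S)) :
    ContMDiffOn ((𝓘(ℝ, E).prod 𝓘(ℝ, ℝ)).prod 𝓘(ℝ, E)) 𝓘(ℝ, V) 1
      (fun p : (G × ℝ) × E => f (p.1.1 * (chartAt E (1 : G)).symm p.2) p.1.2)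
      ((univ ×ˢ S) ×ˢ (chartAt E (1 : G)).target) := by
  have : LieGroup 𝓘(ℝ, E) 1 G := LieGroup.of_le (n := ∞) (mod_cast le_top)
  have h0 : ContMDiffOn 𝓘(ℝ, E) 𝓘(ℝ, E) 1 (chartAt E (1 : G)).symm (chartAt E (1 : G)).target :=
    contMDiffOn_chart_symm
  have h1 : ContMDiffOn ((𝓘(ℝ, E).prod 𝓘(ℝ, ℝ)).prod 𝓘(ℝ, E)) (𝓘(ℝ, E).prod 𝓘(ℝ, ℝ)) 1
      (fun p : (G × ℝ) × E => (p.1.1 * (chartAt E (1 : G)).symm p.2, p.1.2))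
      ((univ ×ˢ S) ×ˢ (chartAt E (1 : G)).target) :=
    ((contMDiff_fst.comp contMDiff_fst).contMDiffOn.mul
      (h0.comp contMDiff_snd.contMDiffOn fun p hp => hp.2)).prodMk
        (contMDiff_snd.comp contMDiff_fst).contMDiffOn
  exact hf.comp h1 fun p hp => ⟨mem_univ _, hp.1.2⟩

theorem differentiableAt_translate
    (hf : ContMDiffOn (𝓘(ℝ, E).prod 𝓘(ℝ, ℝ)) 𝓘(ℝ, V) 1 (fun p : G × ℝ => f p.1 p.2)
      (univ ×ˢ S)) (g : G) {t : ℝ} (ht : t ∈ S) {x : E} (hx : x ∈ (chartAt E (1 : G)).target) :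
    DifferentiableAt ℝ (fun y : E => f (g * (chartAt E (1 : G)).symm y) t) x := by
  have h1 : ContMDiffOn 𝓘(ℝ, E) 𝓘(ℝ, V) 1
      (fun y : E => f (g * (chartAt E (1 : G)).symm y) t) (chartAt E (1 : G)).target :=
    (contMDiffOn_translate hf).comp
      (contMDiff_const.prodMk contMDiff_id : ContMDiff 𝓘(ℝ, E) _ 1
        fun y : E => ((g, t), y)).contMDiffOn fun y hy => ⟨⟨mem_univ _, ht⟩, hy⟩
  exact ((contMDiffOn_iff_contDiffOn.1 h1).contDiffAt
    ((chartAt E (1 : G)).open_target.mem_nhds hx)).differentiableAt (by simp)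

/-- The derivative along the group of a `C¹` function, transported to the chart at the identity,
is jointly continuous. -/
theorem continuousOn_fderiv_translate
    (hf : ContMDiffOn (𝓘(ℝ, E).prod 𝓘(ℝ, ℝ)) 𝓘(ℝ, V) 1 (fun p : G × ℝ => f p.1 p.2)
      (univ ×ˢ S)) (hc : ContinuousOn c S) :
    ContinuousOn (fun p : ℝ × E =>
      fderiv ℝ (fun y : E => f (c p.1 * (chartAt E (1 : G)).symm y) p.1) p.2)
      (S ×ˢ (chartAt E (1 : G)).target) := by
  have : IsManifold 𝓘(ℝ, E) 1 G := IsManifold.of_le (n := ∞) (mod_cast le_top)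
  set U := (chartAt E (1 : G)).target
  have hU : IsOpen U := (chartAt E (1 : G)).open_target
  have key : ContinuousOn (fun q : (G × ℝ) × E =>
      fderiv ℝ (fun y : E => f (q.1.1 * (chartAt E (1 : G)).symm y) q.1.2) q.2)
      ((univ ×ˢ S) ×ˢ U) := by
    intro q hq
    have h1 : ContMDiffWithinAt (((𝓘(ℝ, E).prod 𝓘(ℝ, ℝ)).prod 𝓘(ℝ, E)).prod 𝓘(ℝ, E)) 𝓘(ℝ, V) 1
        (Function.uncurry fun (n : (G × ℝ) × E) (y : E) =>
          f (n.1.1 * (chartAt E (1 : G)).symm y) n.1.2)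
        (((univ ×ˢ S) ×ˢ U) ×ˢ U) (q, q.2) :=
      ((contMDiffOn_translate hf).comp
        ((contMDiff_fst.comp contMDiff_fst).prodMk contMDiff_snd :
          ContMDiff (((𝓘(ℝ, E).prod 𝓘(ℝ, ℝ)).prod 𝓘(ℝ, E)).prod 𝓘(ℝ, E)) _ 1
            fun r : ((G × ℝ) × E) × E => (r.1.1, r.2)).contMDiffOn
        fun r hr => ⟨hr.1.1, hr.2⟩) (q, q.2) ⟨hq, hq.2⟩
    -- The partial derivative in `y` of a map that is jointly `C¹` in parameters and `y` is jointly
    -- continuous; on vector spaces the tangent coordinates involved are trivial.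
    have h2 := ContMDiffWithinAt.mfderivWithin (m := 0) (g := Prod.snd) h1
      contMDiffWithinAt_snd hq (fun r hr => hr.2) (by simp) hU.uniqueMDiffOn
    have h3 : ContinuousWithinAt (fun q : (G × ℝ) × E =>
        fderivWithin ℝ (fun y : E => f (q.1.1 * (chartAt E (1 : G)).symm y) q.1.2) U q.2)
        ((univ ×ˢ S) ×ˢ U) q := by
      have h4 := inTangentCoordinates_model_space (I := 𝓘(ℝ, E)) (I' := 𝓘(ℝ, V)) (Prod.snd : _ → E)
        (fun r : (G × ℝ) × E => f (r.1.1 * (chartAt E (1 : G)).symm r.2) r.1.2)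
        (fun r : (G × ℝ) × E => fderivWithin ℝ
          (fun y : E => f (r.1.1 * (chartAt E (1 : G)).symm y) r.1.2) U r.2) q
      have h5 := h2.continuousWithinAt
      simp only [mfderivWithin_eq_fderivWithin] at h5
      exact Eq.mp (congrArg (fun F => ContinuousWithinAt F ((univ ×ˢ S) ×ˢ U) q) h4) h5
    refine h3.congr (fun r hr => ?_) ?_
    · exact (fderivWithin_of_isOpen hU hr.2).symm
    · exact (fderivWithin_of_isOpen hU hq.2).symm
  have h1 : ContinuousOn (fun p : ℝ × E => ((c p.1, p.1), p.2)) (S ×ˢ U) :=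
    ((hc.comp continuousOn_fst fun p hp => hp.1).prodMk continuousOn_fst).prodMk continuousOn_snd
  exact key.comp h1 fun p hp => ⟨⟨mem_univ _, hp.1⟩, hp.2⟩

end Translate

/-! ### The vector field of the relative motion and its linearization. -/

section RelativeField

variable {E : Type*} [NormedAddCommGroup E] [NormedSpace ℝ E]
  {G : Type*} [TopologicalSpace G] [ChartedSpace E G] [Group G]

/-- The velocity of `c⁻¹ c'` in the chart at the identity, for a curve `c` with left logarithmic
derivative `ξ` and a trajectory `c'` of `f`. -/
noncomputable def relativeField (c : ℝ → G) (ξ : ℝ → E) (f : G → ℝ → E) (t : ℝ) (x : E) : E :=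
  leftFrame E G x (f (c t * (chartAt E (1 : G)).symm x) t) - rightFrame E G x (ξ t)

/-- The derivative of `relativeField` with respect to the space variable. -/
noncomputable def relativeFieldDeriv (c : ℝ → G) (ξ : ℝ → E) (f : G → ℝ → E) (t : ℝ) (x : E) :
    E →L[ℝ] E :=
  (leftFrame E G x).comp (fderiv ℝ (fun y : E => f (c t * (chartAt E (1 : G)).symm y) t) x) +
    (fderiv ℝ (leftFrame E G) x).flip (f (c t * (chartAt E (1 : G)).symm x) t) -
    (fderiv ℝ (rightFrame E G) x).flip (ξ t)

variable [LieGroup 𝓘(ℝ, E) ∞ G] {c : ℝ → G} {ξ : ℝ → E} {f : G → ℝ → E} {S : Set ℝ}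

/-- Gives the needle velocity `f₂ - f₁` for `f = f₂`, and an equilibrium when `f` generates `c`
itself. -/
theorem relativeField_chartOne (t : ℝ) :
    relativeField c ξ f t (chartOne E G) = f (c t) t - ξ t := by
  simp [relativeField, leftFrame_chartOne, rightFrame_chartOne]

theorem hasFDerivAt_relativeField
    (hf : ContMDiffOn (𝓘(ℝ, E).prod 𝓘(ℝ, ℝ)) 𝓘(ℝ, E) 1 (fun p : G × ℝ => f p.1 p.2)
      (univ ×ˢ S)) {t : ℝ} (ht : t ∈ S) {x : E} (hx : x ∈ (chartAt E (1 : G)).target) :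
    HasFDerivAt (relativeField c ξ f t) (relativeFieldDeriv c ξ f t x) x := by
  have h1 := (differentiableAt_leftFrame hx).hasFDerivAt.clm_apply
    (differentiableAt_translate hf (c t) ht hx).hasFDerivAt
  have h2 := (differentiableAt_rightFrame hx).hasFDerivAt.clm_apply (hasFDerivAt_const (ξ t) x)
  have h3 := h1.sub h2
  simp only [ContinuousLinearMap.comp_zero, zero_add] at h3
  exact h3

theorem continuousOn_relativeField
    (hf : ContMDiffOn (𝓘(ℝ, E).prod 𝓘(ℝ, ℝ)) 𝓘(ℝ, E) 1 (fun p : G × ℝ => f p.1 p.2)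
      (univ ×ˢ S)) (hc : ContinuousOn c S) (hξ : ContinuousOn ξ S) :
    ContinuousOn (fun p : ℝ × E => relativeField c ξ f p.1 p.2)
      (S ×ˢ (chartAt E (1 : G)).target) := by
  have hl : ContinuousOn (fun p : ℝ × E => leftFrame E G p.2) (S ×ˢ (chartAt E (1 : G)).target) :=
    contDiffOn_leftFrame.continuousOn.comp continuousOn_snd fun p hp => hp.2
  have hr : ContinuousOn (fun p : ℝ × E => rightFrame E G p.2) (S ×ˢ (chartAt E (1 : G)).target) :=
    contDiffOn_rightFrame.continuousOn.comp continuousOn_snd fun p hp => hp.2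
  exact (hl.clm_apply (continuousOn_translate hf hc)).sub
    (hr.clm_apply (hξ.comp continuousOn_fst fun p hp => hp.1))

theorem continuousOn_relativeFieldDeriv
    (hf : ContMDiffOn (𝓘(ℝ, E).prod 𝓘(ℝ, ℝ)) 𝓘(ℝ, E) 1 (fun p : G × ℝ => f p.1 p.2)
      (univ ×ˢ S)) (hc : ContinuousOn c S) (hξ : ContinuousOn ξ S) :
    ContinuousOn (fun p : ℝ × E => relativeFieldDeriv c ξ f p.1 p.2)
      (S ×ˢ (chartAt E (1 : G)).target) := by
  have hU := (chartAt E (1 : G)).open_target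
  have hl : ContinuousOn (fun p : ℝ × E => leftFrame E G p.2) (S ×ˢ (chartAt E (1 : G)).target) :=
    contDiffOn_leftFrame.continuousOn.comp continuousOn_snd fun p hp => hp.2
  have hl' : ContinuousOn (fun p : ℝ × E => (fderiv ℝ (leftFrame E G) p.2).flip)
      (S ×ˢ (chartAt E (1 : G)).target) :=
    (ContinuousLinearMap.flipₗᵢ ℝ E E E).continuous.comp_continuousOn
      ((contDiffOn_leftFrame.continuousOn_fderiv_of_isOpen hU (by simp)).comp continuousOn_snd
        fun p hp => hp.2)
  have hr' : ContinuousOn (fun p : ℝ × E => (fderiv ℝ (rightFrame E G) p.2).flip)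
      (S ×ˢ (chartAt E (1 : G)).target) :=
    (ContinuousLinearMap.flipₗᵢ ℝ E E E).continuous.comp_continuousOn
      ((contDiffOn_rightFrame.continuousOn_fderiv_of_isOpen hU (by simp)).comp continuousOn_snd
        fun p hp => hp.2)
  exact ((hl.clm_comp (continuousOn_fderiv_translate hf hc)).add
    (hl'.clm_apply (continuousOn_translate hf hc))).sub
      (hr'.clm_apply (hξ.comp continuousOn_fst fun p hp => hp.1))

theorem relativeFieldDeriv_chartOne_apply (t : ℝ) (v : E) :
    relativeFieldDeriv c ξ f t (chartOne E G) v =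
      fderiv ℝ (fun y : E => f (c t * (chartAt E (1 : G)).symm y) t) (chartOne E G) v +
        fderiv ℝ (leftFrame E G) (chartOne E G) v (f (c t) t) -
        fderiv ℝ (leftFrame E G) (chartOne E G) (ξ t) v := by
  simp only [relativeFieldDeriv, sub_apply, add_apply, ContinuousLinearMap.comp_apply,
    ContinuousLinearMap.flip_apply, chart_symm_chartOne, mul_one, leftFrame_chartOne,
    fderiv_rightFrame_chartOne]

/-- The linearization of the relative motion at the identity is `D_g f - ad_f`. -/
theorem relativeFieldDeriv_chartOne [FiniteDimensional ℝ E] [T2Space G]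
    {f : G → ℝ → GroupLieAlgebra 𝓘(ℝ, E) G}
    (hf : ContMDiffOn (M' := E) (𝓘(ℝ, E).prod 𝓘(ℝ, ℝ)) 𝓘(ℝ, E) 1 (fun p : G × ℝ => f p.1 p.2)
      (univ ×ˢ S)) {t : ℝ} (ht : t ∈ S) (η : GroupLieAlgebra 𝓘(ℝ, E) G) :
    leftDeriv (fun x => f x t) (c t) η - ⁅f (c t) t, η⁆ =
      relativeFieldDeriv (E := E) c (fun s => f (c s) s) f t (chartOne E G) (η : E) := by
  have h1 : leftDeriv (fun x => f x t) (c t) η =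
      fderiv ℝ (fun y : E => (f (c t * (chartAt E (1 : G)).symm y) t : E)) (chartOne E G) (η : E) :=
    leftDeriv_eq_of_hasFDerivAt (V := E) (f := fun x => f x t)
      (differentiableAt_translate (V := E) hf (c t) ht chartOne_mem_target).hasFDerivAt η
  have h2 := bracket_eq_fderiv_leftFrame (f (c t) t) η
  rw [h1, h2]
  have h3 : ∀ x a d : E, x - (a - d) = x + d - a := fun x a d => by abel
  exact (h3 _ _ _).trans
    (relativeFieldDeriv_chartOne_apply (E := E) (ξ := fun s => f (c s) s) t η).symm

end RelativeField

/-! ### The costate equation in coordinates and its solvability. -/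

section Costate

variable {E : Type*} [NormedAddCommGroup E] [NormedSpace ℝ E]
  {G : Type*} [TopologicalSpace G] [ChartedSpace E G]

/-- Makes the results on time-dependent maps applicable to the running cost. -/
theorem contMDiffOn_fst_comp {L : G → ℝ} (hL : ContMDiff 𝓘(ℝ, E) 𝓘(ℝ, ℝ) 1 L) (S : Set ℝ) :
    ContMDiffOn (𝓘(ℝ, E).prod 𝓘(ℝ, ℝ)) 𝓘(ℝ, ℝ) 1 (fun p : G × ℝ => L p.1) (univ ×ˢ S) :=
  (hL.comp contMDiff_fst).contMDiffOn

theorem continuousOn_along {f : G → ℝ → E} {S : Set ℝ}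
    (hf : ContMDiffOn (𝓘(ℝ, E).prod 𝓘(ℝ, ℝ)) 𝓘(ℝ, E) 1 (fun p : G × ℝ => f p.1 p.2)
      (univ ×ˢ S)) {c : ℝ → G} (hc : ContinuousOn c S) : ContinuousOn (fun s => f (c s) s) S :=
  hf.continuousOn.comp (hc.prodMk continuousOn_id) fun _ hs => ⟨mem_univ _, hs⟩

variable [Group G] [LieGroup 𝓘(ℝ, E) ∞ G]

/-- The derivative along the group of a real function, in the chart at the identity. -/
noncomputable def chartGradient (L : G → ℝ) (g : G) : E →L[ℝ] ℝ :=
  fderiv ℝ (fun y : E => L (g * (chartAt E (1 : G)).symm y)) (chartOne E G)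

theorem hasFDerivAt_chartGradient {L : G → ℝ} (hL : MDifferentiable 𝓘(ℝ, E) 𝓘(ℝ, ℝ) L) (g : G) :
    HasFDerivAt (fun y : E => L (g * (chartAt E (1 : G)).symm y)) (chartGradient L g)
      (chartOne E G) := by
  have h1 : MDifferentiableAt 𝓘(ℝ, E) 𝓘(ℝ, ℝ)
      (fun y : E => L (g * (chartAt E (1 : G)).symm y)) (chartOne E G) :=
    (hL _).comp (chartOne E G) ((hasMFDerivAt_mul_left g _).mdifferentiableAt.comp (chartOne E G)
      hasMFDerivAt_chart_symm_chartOne.mdifferentiableAt)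
  exact h1.differentiableAt.hasFDerivAt

theorem continuousOn_chartGradient {L : G → ℝ} (hL : ContMDiff 𝓘(ℝ, E) 𝓘(ℝ, ℝ) 1 L) {S : Set ℝ}
    {c : ℝ → G} (hc : ContinuousOn c S) :
    ContinuousOn (fun t => (chartGradient L (c t) : E →L[ℝ] ℝ)) S := by
  have h := continuousOn_fderiv_translate (f := fun g _ => L g) (contMDiffOn_fst_comp hL S) hc
  exact h.comp (continuousOn_id.prodMk continuousOn_const) fun t ht => ⟨ht, chartOne_mem_target⟩

/-- The coefficient `D_g f - ad_f` of the costate equation along a curve. -/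
noncomputable def costateCoeff (f : G → ℝ → E) (c : ℝ → G) (t : ℝ) : E →L[ℝ] E :=
  relativeFieldDeriv c (fun s => f (c s) s) f t (chartOne E G)

theorem continuousOn_costateCoeff {f : G → ℝ → E} {S : Set ℝ}
    (hf : ContMDiffOn (𝓘(ℝ, E).prod 𝓘(ℝ, ℝ)) 𝓘(ℝ, E) 1 (fun p : G × ℝ => f p.1 p.2)
      (univ ×ˢ S)) {c : ℝ → G} (hc : ContinuousOn c S) : ContinuousOn (costateCoeff f c) S :=
  ContinuousOn.comp (f := fun t : ℝ => (t, chartOne E G))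
    (continuousOn_relativeFieldDeriv hf hc (continuousOn_along hf hc))
    (continuousOn_id.prodMk continuousOn_const) fun _ ht => ⟨ht, chartOne_mem_target⟩

variable [FiniteDimensional ℝ E] [T2Space G]

theorem leftDeriv_eq_chartGradient {L : G → ℝ} (hL : MDifferentiable 𝓘(ℝ, E) 𝓘(ℝ, ℝ) L) (g : G)
    (η : GroupLieAlgebra 𝓘(ℝ, E) G) : leftDeriv L g η = chartGradient (E := E) L g η :=
  leftDeriv_eq_of_hasFDerivAt (hasFDerivAt_chartGradient hL g) η

variable {f : G → ℝ → GroupLieAlgebra 𝓘(ℝ, E) G} {L φ : G → ℝ} {a b : ℝ} {c : ℝ → G}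

/-- The costate equation as a differential equation for continuous linear forms on the model
space. -/
theorem isCostate_iff
    (hf : ContMDiffOn (M' := E) (𝓘(ℝ, E).prod 𝓘(ℝ, ℝ)) 𝓘(ℝ, E) 1 (fun p : G × ℝ => f p.1 p.2)
      (univ ×ˢ Icc a b))
    (hL : ContMDiff 𝓘(ℝ, E) 𝓘(ℝ, ℝ) 1 L) (hφ : MDifferentiable 𝓘(ℝ, E) 𝓘(ℝ, ℝ) φ)
    (R : ℝ → E →L[ℝ] ℝ) (ρ : ℝ → Module.Dual ℝ (GroupLieAlgebra 𝓘(ℝ, E) G))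
    (hρ : ∀ t (v : E), ρ t v = R t v) :
    IsCostate f L φ a b c ρ ↔ (∀ t ∈ Icc a b, HasDerivWithinAt R
      (-(R t ∘L costateCoeff (E := E) f c t) - chartGradient L (c t)) (Icc a b) t) ∧
      R b = chartGradient φ (c b) := by
  have hL' := hL.mdifferentiable (by simp)
  have hval : ∀ s ∈ Icc a b, ∀ η : GroupLieAlgebra 𝓘(ℝ, E) G,
      -(ρ s (leftDeriv (fun x => f x s) (c s) η - ⁅f (c s) s, η⁆)) - leftDeriv L (c s) η =
        (-(R s ∘L costateCoeff (E := E) f c s) - chartGradient (E := E) L (c s) : E →L[ℝ] ℝ) η := by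
    intro s hs η
    rw [relativeFieldDeriv_chartOne hf hs, leftDeriv_eq_chartGradient hL', hρ]
    rfl
  have hfun : ∀ η : E, (fun t => ρ t η) = fun t => R t η := fun η => funext fun t => hρ t η
  constructor
  · rintro ⟨h1, h2⟩
    refine ⟨fun t ht => hasDerivWithinAt_dual_of_forall_apply fun v => ?_, ?_⟩
    · have h3 : ∀ η : GroupLieAlgebra 𝓘(ℝ, E) G, HasDerivWithinAt (fun t => ρ t η)
          ((-(R t ∘L costateCoeff (E := E) f c t) - chartGradient (E := E) L (c t) :
            E →L[ℝ] ℝ) η) (Icc a b) t := fun η => by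
        rw [← hval t ht]
        exact h1 t ht η
      exact (hfun v) ▸ h3 v
    · ext v
      exact (hρ b v).symm.trans ((h2 v).trans (leftDeriv_eq_chartGradient hφ (c b) v))
  · rintro ⟨h1, h2⟩
    refine ⟨fun t ht η => ?_, fun η => ?_⟩
    · rw [hval t ht]
      have h3 := (h1 t ht).clm_apply (hasDerivWithinAt_const (F := E) t (Icc a b) η)
      simp only [map_zero, add_zero] at h3
      exact (hfun η).symm ▸ h3
    · rw [leftDeriv_eq_chartGradient hφ, ← h2]
      exact hρ b η

/-- In coordinates this is a terminal value problem for an affine equation on `E →L[ℝ] ℝ`, with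
linear part `R ↦ -R ∘ A(t)` and continuous coefficients. -/
theorem exists_isCostate (hab : a ≤ b)
    (hf : ContMDiffOn (M' := E) (𝓘(ℝ, E).prod 𝓘(ℝ, ℝ)) 𝓘(ℝ, E) 1 (fun p : G × ℝ => f p.1 p.2)
      (univ ×ˢ Icc a b))
    (hL : ContMDiff 𝓘(ℝ, E) 𝓘(ℝ, ℝ) 1 L) (hφ : MDifferentiable 𝓘(ℝ, E) 𝓘(ℝ, ℝ) φ)
    (hc : ContinuousOn c (Icc a b)) :
    ∃ ρ : ℝ → Module.Dual ℝ (GroupLieAlgebra 𝓘(ℝ, E) G), IsCostate f L φ a b c ρ := by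
  have hA := continuousOn_costateCoeff (E := E) (f := f) hf hc
  obtain ⟨R, hR1, hR2⟩ := exists_hasDerivWithinAt_affine_terminal (X := E →L[ℝ] ℝ) hab
    (B := fun t => -(ContinuousLinearMap.compL ℝ E E ℝ).flip (costateCoeff (E := E) f c t))
    (c := fun t => -chartGradient L (c t))
    (((ContinuousLinearMap.compL ℝ E E ℝ).flip.continuous.comp_continuousOn hA).neg)
    (continuousOn_chartGradient hL hc).neg (chartGradient φ (c b))
  refine ⟨fun t => (R t : E →ₗ[ℝ] ℝ), (isCostate_iff hf hL hφ R _ fun t v => rfl).2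
    ⟨fun t ht => ?_, hR1⟩⟩
  have h := hR2 t ht
  rw [sub_eq_add_neg]
  exact h

end Costate

/-! ### Displacement caused by the inserted mode. -/

section Needle

theorem insertedMode_of_mem {G V : Type*} {f₁ f₂ : G → ℝ → V} {g : G} {τ lam t : ℝ}
    (ht : t ∈ Ico τ (τ + lam)) : insertedMode f₁ f₂ τ lam g t = f₂ g t :=
  if_pos ht

theorem insertedMode_of_notMem {G V : Type*} {f₁ f₂ : G → ℝ → V} {g : G} {τ lam t : ℝ}
    (ht : t ∉ Ico τ (τ + lam)) : insertedMode f₁ f₂ τ lam g t = f₁ g t :=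
  if_neg ht

theorem insertedMode_zero {G V : Type*} (f₁ f₂ : G → ℝ → V) (τ : ℝ) :
    insertedMode f₁ f₂ τ 0 = f₁ := by
  funext g t
  exact insertedMode_of_notMem (by simp)

variable {E : Type*} [NormedAddCommGroup E] [NormedSpace ℝ E]
  {G : Type*} [TopologicalSpace G] [ChartedSpace E G] [Group G] [LieGroup 𝓘(ℝ, E) ∞ G]
  {f₁ f₂ : G → ℝ → E} {a b τ lam : ℝ} {g₀ : G}

theorem IsTrajectory.hasDerivWithinAt_chart {f : G → ℝ → E} {c c' : ℝ → G}
    (hc : IsTrajectory f₁ a b g₀ c) (hc' : IsTrajectory f a b g₀ c') {t : ℝ} (ht : t ∈ Ico a b)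
    (hmem : (c t)⁻¹ * c' t ∈ (chartAt E (1 : G)).source) :
    HasDerivWithinAt (fun u => chartAt E (1 : G) ((c u)⁻¹ * c' u))
      (relativeField (E := E) c (fun s => f₁ (c s) s) f t (chartAt E (1 : G) ((c t)⁻¹ * c' t)))
      (Ici t) t := by
  have h := hasDerivWithinAt_chart_inv_mul_curves (E := E) (uniqueDiffWithinAt_Ici t)
    self_mem_Ici (hc.ode t ht) (hc'.ode t ht) hmem
  have h2 : c t * (chartAt E (1 : G)).symm (chartAt E (1 : G) ((c t)⁻¹ * c' t)) = c' t := by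
    rw [(chartAt E (1 : G)).left_inv hmem, mul_inv_cancel_left]
  rw [relativeField, h2]
  exact h

theorem IsTrajectory.continuousOn_inv_mul {f f' : G → ℝ → E} {c c' : ℝ → G}
    (hc : IsTrajectory f a b g₀ c) (hc' : IsTrajectory f' a b g₀ c') :
    ContinuousOn (fun t => (c t)⁻¹ * c' t) (Icc a b) := by
  have : IsTopologicalGroup G := topologicalGroup_of_lieGroup 𝓘(ℝ, E) ∞
  exact hc.cont.inv.mul hc'.cont

variable [FiniteDimensional ℝ E] [T2Space G]

/-- Inserting a mode for a time `lam` displaces the trajectory by at most `C * lam`, and does not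
displace it before the switching time. -/
theorem exists_norm_chart_le (hτ : a ≤ τ) (hτb : τ < b)
    (hf₁ : ContMDiffOn (𝓘(ℝ, E).prod 𝓘(ℝ, ℝ)) 𝓘(ℝ, E) 1 (fun p : G × ℝ => f₁ p.1 p.2)
      (univ ×ˢ Icc a b))
    (hf₂ : ContMDiffOn (𝓘(ℝ, E).prod 𝓘(ℝ, ℝ)) 𝓘(ℝ, E) 1 (fun p : G × ℝ => f₂ p.1 p.2)
      (univ ×ˢ Icc a b))
    {c : ℝ → G} (hc : IsTrajectory f₁ a b g₀ c) :
    ∃ C ≥ 0, ∀ᶠ lam in 𝓝[>] (0 : ℝ), ∀ c' : ℝ → G,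
      IsTrajectory (insertedMode f₁ f₂ τ lam) a b g₀ c' →
        (∀ t ∈ Icc a τ, c' t = c t) ∧ ∀ t ∈ Icc a b,
          (c t)⁻¹ * c' t ∈ (chartAt E (1 : G)).source ∧
            ‖chartAt E (1 : G) ((c t)⁻¹ * c' t) - chartOne E G‖ ≤ C * lam := by
  set χ := chartAt E (1 : G)
  set e := chartOne E G
  have hU : IsOpen χ.target := χ.open_target
  have he : e ∈ χ.target := chartOne_mem_target
  have hξ := continuousOn_along (E := E) (f := f₁) hf₁ hc.cont
  have ham : a ∈ Icc a b := ⟨le_rfl, hτ.trans hτb.le⟩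
  obtain ⟨r₀, hr₀, hball⟩ := Metric.isOpen_iff.1 hU e he
  obtain ⟨δ, hδ, hlin⟩ := exists_uniform_linearization (X := E) isCompact_Icc hU he
    (fun t ht x hx => hasFDerivAt_relativeField (E := E) (f := f₁) (ξ := fun s => f₁ (c s) s)
      (c := c) hf₁ ht hx)
    (continuousOn_relativeFieldDeriv (E := E) (f := f₁) hf₁ hc.cont hξ) one_pos
  obtain ⟨K, hK⟩ := isCompact_Icc.exists_bound_of_continuousOn
    (continuousOn_costateCoeff (E := E) (f := f₁) hf₁ hc.cont)
  have hK0 : 0 ≤ K := (norm_nonneg _).trans (hK a ham)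
  -- Small enough for the closed ball to lie in the chart and for the linear estimate of the `f₁`
  -- field to hold on it.
  set r := min (r₀ / 2) δ
  have hr : 0 < r := lt_min (half_pos hr₀) hδ
  have hrt : Metric.closedBall e r ⊆ χ.target :=
    (Metric.closedBall_subset_ball ((min_le_left _ _).trans_lt (half_lt_self hr₀))).trans hball
  have : ProperSpace E := FiniteDimensional.proper ℝ E
  obtain ⟨M, hM⟩ := (isCompact_Icc.prod (isCompact_closedBall e r)).exists_bound_of_continuousOn
    ((continuousOn_relativeField (E := E) (f := f₂) hf₂ hc.cont hξ).mono
      (prod_mono subset_rfl hrt))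
  have hM0 : 0 ≤ M := (norm_nonneg _).trans (hM (a, e) ⟨ham, Metric.mem_closedBall_self hr.le⟩)
  have hF₁ : ∀ t ∈ Icc a b, ∀ x : E, ‖x - e‖ < r →
      ‖relativeField (E := E) c (fun s => f₁ (c s) s) f₁ t x‖ ≤ (K + 1) * ‖x - e‖ + 0 := by
    intro t ht x hx
    have h1 := hlin t ht x (hx.le.trans (min_le_right _ _))
    have h0 : relativeField (E := E) c (fun s => f₁ (c s) s) f₁ t e = 0 := by
      rw [relativeField_chartOne]; exact sub_self _
    rw [h0, sub_zero] at h1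
    have h2 := (costateCoeff (E := E) f₁ c t).le_of_opNorm_le (hK t ht) (x - e)
    have h3 := norm_add_le (relativeField (E := E) c (fun s => f₁ (c s) s) f₁ t x -
      costateCoeff (E := E) f₁ c t (x - e)) (costateCoeff (E := E) f₁ c t (x - e))
    rw [sub_add_cancel] at h3
    have h4 : ‖relativeField (E := E) c (fun s => f₁ (c s) s) f₁ t x -
      costateCoeff (E := E) f₁ c t (x - e)‖ ≤ 1 * ‖x - e‖ := h1
    linarith
  set X := Real.exp ((K + 1) * (b - a))
  have hX : 1 ≤ X := Real.one_le_exp (mul_nonneg (by linarith) (by linarith [ham.2]))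
  have hMX : M ≤ M * X := le_mul_of_one_le_right hM0 hX
  refine ⟨M * X, by positivity, ?_⟩
  have hsm : ∀ᶠ lam in 𝓝[>] (0 : ℝ), M * X * lam < r := by
    have : Tendsto (fun lam : ℝ => M * X * lam) (𝓝 (0 : ℝ)) (𝓝 (M * X * 0)) :=
      (continuous_const.mul continuous_id).tendsto _
    rw [mul_zero] at this
    exact (this.mono_left nhdsWithin_le_nhds).eventually (gt_mem_nhds hr)
  have hlb : ∀ᶠ lam in 𝓝[>] (0 : ℝ), lam < b - τ :=
    nhdsWithin_le_nhds (gt_mem_nhds (sub_pos.2 hτb))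
  filter_upwards [hsm, hlb, self_mem_nhdsWithin] with lam hsm hlb hpos c' hc'
  rw [mem_Ioi] at hpos
  have hcont := hc.continuousOn_inv_mul hc'
  have hder : ∀ t ∈ Ico a b, (c t)⁻¹ * c' t ∈ χ.source → HasDerivWithinAt
      (fun u => χ ((c u)⁻¹ * c' u)) (relativeField (E := E) c (fun s => f₁ (c s) s)
        (insertedMode f₁ f₂ τ lam) t (χ ((c t)⁻¹ * c' t))) (Ici t) t := fun t ht hm =>
    hc.hasDerivWithinAt_chart hc' ht hm
  have hder₁ : ∀ t ∈ Ico a b, t ∉ Ico τ (τ + lam) → (c t)⁻¹ * c' t ∈ χ.source →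
      ‖χ ((c t)⁻¹ * c' t) - e‖ < r → ∃ v, HasDerivWithinAt
      (fun u => χ ((c u)⁻¹ * c' u)) v (Ici t) t ∧
        ‖v‖ ≤ (K + 1) * ‖χ ((c t)⁻¹ * c' t) - e‖ + 0 := fun t ht htn hm hr => by
    refine ⟨_, hder t ht hm, ?_⟩
    have h := hF₁ t ⟨ht.1, ht.2.le⟩ _ hr
    rw [relativeField] at h ⊢
    rwa [insertedMode_of_notMem htn]
  have hbr : Metric.ball e r ⊆ χ.target := Metric.ball_subset_closedBall.trans hrt
  have hinit : (c a)⁻¹ * c' a = 1 := by rw [hc.init, hc'.init, inv_mul_cancel]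
  -- Three successive Grönwall estimates: bound 0 before the switch, linear growth at rate `M` on
  -- the needle, exponential growth at rate `K + 1` from at most `M λ` afterwards.
  have h1 := norm_chart_le_gronwallBound χ hbr (h := fun t => (c t)⁻¹ * c' t) (a := a) (b := τ)
    (δ := 0) (K := K + 1) (ε := 0) le_rfl (by linarith) le_rfl hτ
    (hcont.mono (Icc_subset_Icc_right hτb.le)) (by simp only [hinit]; exact mem_chart_source E 1)
    (by simp [hinit, e, χ, chartOne])
    (fun t ht => hder₁ t ⟨ht.1, ht.2.trans hτb⟩ fun h => absurd h.1 (not_le.2 ht.2))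
    (by rw [gronwallBound_ε0_δ0]; exact hr)
  simp only [gronwallBound_ε0_δ0] at h1
  have hτm : τ ∈ Icc a τ := ⟨hτ, le_rfl⟩
  have h2 := norm_chart_le_gronwallBound χ hbr (h := fun t => (c t)⁻¹ * c' t) (a := τ)
    (b := τ + lam) (δ := 0) (K := 0) (ε := M) le_rfl le_rfl hM0 (by linarith)
    (hcont.mono (Icc_subset_Icc hτ (by linarith))) (h1 τ hτm).1 (h1 τ hτm).2
    (fun t ht hm hr => by
      have ht' : t ∈ Ico a b := ⟨hτ.trans ht.1, by linarith [ht.2]⟩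
      refine ⟨_, hder t ht' hm, ?_⟩
      have h := hM (t, χ ((c t)⁻¹ * c' t)) ⟨⟨ht'.1, ht'.2.le⟩, by
        rw [Metric.mem_closedBall, dist_eq_norm]; exact hr.le⟩
      rw [zero_mul, zero_add]
      simp only [relativeField] at h ⊢
      rwa [insertedMode_of_mem ht])
    (by
      simp only [gronwallBound_K0]
      nlinarith)
  simp only [gronwallBound_K0, zero_add] at h2
  have hlm : τ + lam ∈ Icc τ (τ + lam) := ⟨by linarith, le_rfl⟩
  have hexp : ∀ t ∈ Icc (τ + lam) b, M * lam * Real.exp ((K + 1) * (t - (τ + lam))) ≤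
      M * X * lam := fun t ht => by
    have : Real.exp ((K + 1) * (t - (τ + lam))) ≤ X :=
      Real.exp_le_exp.2 (mul_le_mul_of_nonneg_left (by linarith [ht.2]) (by linarith))
    calc _ ≤ M * lam * X := by gcongr
      _ = _ := by ring
  have h3 := norm_chart_le_gronwallBound χ hbr (h := fun t => (c t)⁻¹ * c' t) (a := τ + lam)
    (b := b) (δ := M * lam) (K := K + 1) (ε := 0) (by positivity) (by linarith) le_rfl
    (by linarith) (hcont.mono (Icc_subset_Icc_left (by linarith))) (h2 _ hlm).1
    (by simpa using (h2 _ hlm).2)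
    (fun t ht => hder₁ t ⟨by linarith [ht.1], ht.2⟩ fun h => absurd h.2 (not_lt.2 ht.1))
    (by rw [gronwallBound_ε0]; exact (hexp b ⟨by linarith, le_rfl⟩).trans_lt hsm)
  simp only [gronwallBound_ε0] at h3
  have hC0 : 0 ≤ M * X * lam := by positivity
  refine ⟨fun t ht => ?_, fun t ht => ?_⟩
  · obtain ⟨h4, h5⟩ := h1 t ht
    have h6 : χ ((c t)⁻¹ * c' t) = χ 1 := by
      have := sub_eq_zero.1 (norm_le_zero_iff.1 h5)
      exact this
    -- Zero displacement in coordinates gives equality in the group, since the chart is injective on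
    -- its domain.
    have h7 := χ.injOn h4 (mem_chart_source E 1) h6
    exact (inv_mul_eq_one.1 h7).symm
  · rcases le_total t τ with h | h
    · exact ⟨(h1 t ⟨ht.1, h⟩).1, (h1 t ⟨ht.1, h⟩).2.trans hC0⟩
    rcases le_total t (τ + lam) with h' | h'
    · refine ⟨(h2 t ⟨h, h'⟩).1, (h2 t ⟨h, h'⟩).2.trans ?_⟩
      calc M * (t - τ) ≤ M * lam := by gcongr; linarith
        _ ≤ M * X * lam := by gcongr
    · exact ⟨(h3 t ⟨h', ht.2⟩).1, (h3 t ⟨h', ht.2⟩).2.trans (hexp t ⟨h', ht.2⟩)⟩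

end Needle

/-! ### First-order variation of the cost. -/

theorem cost_sub_cost {G : Type*} {L : G → ℝ} (φ : G → ℝ) {a b τ : ℝ} (hτ : a ≤ τ) (hτb : τ ≤ b)
    {c c' : ℝ → G} (heq : ∀ t ∈ Icc a τ, c' t = c t)
    (hc' : ContinuousOn (fun t => L (c' t)) (Icc a b))
    (hc : ContinuousOn (fun t => L (c t)) (Icc a b)) :
    cost L φ a b c' - cost L φ a b c =
      (∫ t in τ..b, (L (c' t) - L (c t))) + (φ (c' b) - φ (c b)) := by
  have hi : ∀ {u : ℝ → ℝ}, ContinuousOn u (Icc a b) → IntervalIntegrable u volume a b :=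
    fun hu => ContinuousOn.intervalIntegrable (by rwa [uIcc_of_le (hτ.trans hτb)])
  have hz : ∫ t in a..τ, (L (c' t) - L (c t)) = 0 := by
    rw [intervalIntegral.integral_congr (g := fun _ => (0 : ℝ))]
    · simp
    · intro t ht
      rw [uIcc_of_le hτ] at ht
      simp only [heq t ht, sub_self]
  have hd : IntervalIntegrable (fun t => L (c' t) - L (c t)) volume a b := hi (hc'.sub hc)
  have hadd := intervalIntegral.integral_add_adjacent_intervals (b := τ)
    (hd.mono_set (by
      rw [uIcc_of_le hτ, uIcc_of_le (hτ.trans hτb)]; exact Icc_subset_Icc_right hτb))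
    (hd.mono_set (by
      rw [uIcc_of_le hτb, uIcc_of_le (hτ.trans hτb)]; exact Icc_subset_Icc_left hτ))
  rw [hz, zero_add, intervalIntegral.integral_sub (hi hc') (hi hc)] at hadd
  rw [hadd, cost, cost]
  ring

/-- The first-order effect on the cost of inserting the mode `f₂` for a time `lam`. -/
theorem hasDerivWithinAt_cost {E : Type*} [NormedAddCommGroup E] [NormedSpace ℝ E]
    [FiniteDimensional ℝ E] {G : Type*} [TopologicalSpace G] [ChartedSpace E G] [Group G]
    [LieGroup 𝓘(ℝ, E) ∞ G] [T2Space G] {f₁ f₂ : G → ℝ → E} {L φ : G → ℝ} {a b τ : ℝ} {g₀ : G}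
    (hτ : a ≤ τ) (hτb : τ < b)
    (hf₁ : ContMDiffOn (𝓘(ℝ, E).prod 𝓘(ℝ, ℝ)) 𝓘(ℝ, E) 1 (fun p : G × ℝ => f₁ p.1 p.2)
      (univ ×ˢ Icc a b))
    (hf₂ : ContMDiffOn (𝓘(ℝ, E).prod 𝓘(ℝ, ℝ)) 𝓘(ℝ, E) 1 (fun p : G × ℝ => f₂ p.1 p.2)
      (univ ×ˢ Icc a b))
    (hL : ContMDiff 𝓘(ℝ, E) 𝓘(ℝ, ℝ) 1 L) (hφ : MDifferentiable 𝓘(ℝ, E) 𝓘(ℝ, ℝ) φ)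
    {γ : ℝ → ℝ → G} (hc : IsTrajectory f₁ a b g₀ (γ 0))
    (hγ : ∀ᶠ lam in 𝓝[≥] (0 : ℝ), IsTrajectory (insertedMode f₁ f₂ τ lam) a b g₀ (γ lam))
    {R : ℝ → E →L[ℝ] ℝ}
    (hR : ∀ t ∈ Icc a b, HasDerivWithinAt R
      (-(R t ∘L costateCoeff f₁ (γ 0) t) - chartGradient L (γ 0 t)) (Icc a b) t)
    (hRb : R b = chartGradient φ (γ 0 b)) :
    HasDerivWithinAt (fun lam => cost L φ a b (γ lam))
      (R τ (f₂ (γ 0 τ) τ - f₁ (γ 0 τ) τ)) (Ici 0) 0 := by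
  set c := γ 0
  set χ := chartAt E (1 : G)
  set e := chartOne E G
  set ξ : ℝ → E := fun s => f₁ (c s) s
  have hab : a ≤ b := hτ.trans hτb.le
  have hsub : Icc τ b ⊆ Icc a b := Icc_subset_Icc_left hτ
  have hU : IsOpen χ.target := χ.open_target
  have he : e ∈ χ.target := chartOne_mem_target
  have hξ : ContinuousOn ξ (Icc a b) := continuousOn_along hf₁ hc.cont
  have hL' := contMDiffOn_fst_comp hL (Icc a b)
  obtain ⟨C, hC, hdisp⟩ := exists_norm_chart_le hτ hτb hf₁ hf₂ hc
  obtain ⟨K₁, hK₁⟩ := isCompact_Icc.exists_bound_of_continuousOn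
    (continuousOn_costateCoeff hf₁ hc.cont)
  obtain ⟨K₂, hK₂⟩ := isCompact_Icc.exists_bound_of_continuousOn
    (continuousOn_chartGradient hL hc.cont)
  have hγ' : ∀ᶠ lam in 𝓝[>] (0 : ℝ), IsTrajectory (insertedMode f₁ f₂ τ lam) a b g₀ (γ lam) :=
    hγ.filter_mono (nhdsWithin_mono _ Ioi_subset_Ici_self)
  have hlb : ∀ᶠ lam in 𝓝[>] (0 : ℝ), lam < b - τ :=
    nhdsWithin_le_nhds (gt_mem_nhds (sub_pos.2 hτb))
  -- Recentred at `e`, since the chart need not send the identity to 0.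
  let x : ℝ → ℝ → E := fun lam t => χ ((c t)⁻¹ * γ lam t) - e
  have hgood : ∀ᶠ lam in 𝓝[>] (0 : ℝ), (∀ t ∈ Icc a τ, γ lam t = c t) ∧
      ∀ t ∈ Icc a b, c t * χ.symm (e + x lam t) = γ lam t ∧ ‖x lam t‖ ≤ C * lam := by
    filter_upwards [hdisp, hγ'] with lam h1 h2
    refine ⟨(h1 _ h2).1, fun t ht => ⟨?_, ((h1 _ h2).2 t ht).2⟩⟩
    rw [add_sub_cancel, χ.left_inv ((h1 _ h2).2 t ht).1, mul_inv_cancel_left]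
  have hder : ∀ᶠ lam in 𝓝[>] (0 : ℝ), ∀ t ∈ Ico a b, HasDerivWithinAt (x lam)
      (relativeField c ξ (insertedMode f₁ f₂ τ lam) t (e + x lam t)) (Ici t) t := by
    filter_upwards [hdisp, hγ'] with lam h1 h2 t ht
    have h3 := hc.hasDerivWithinAt_chart h2 ht ((h1 _ h2).2 t ⟨ht.1, ht.2.le⟩).1
    simp only [x, add_sub_cancel]
    exact h3.sub_const e
  have hLc : ∀ᶠ lam in 𝓝[>] (0 : ℝ), ContinuousOn (fun t => L (γ lam t)) (Icc a b) := by
    filter_upwards [hγ'] with lam h using hL.continuous.comp_continuousOn h.cont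
  have hLc0 : ContinuousOn (fun t => L (c t)) (Icc a b) := hL.continuous.comp_continuousOn hc.cont
  have hrel : ∀ (f f' : G → ℝ → E) (t : ℝ) (y : E), (∀ g, f g t = f' g t) →
      relativeField c ξ f t y = relativeField c ξ f' t y := fun f f' t y h => by
    simp only [relativeField, h]
  have key := isLittleO_needle (x := x) (F₁ := fun t y => relativeField c ξ f₁ t (e + y))
    (F₂ := fun t y => relativeField c ξ f₂ t (e + y)) (A := costateCoeff f₁ c)
    (l := fun t y => L (c t * χ.symm (e + y)) - L (c t)) (dl := fun t => chartGradient L (c t))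
    (ρ := R) (w := f₂ (c τ) τ - f₁ (c τ) τ) (K := max K₁ K₂) hτb hC
    (by
      filter_upwards [hdisp, hγ'] with lam h1 h2
      refine ContinuousOn.sub ?_ continuousOn_const
      exact (χ.continuousOn.comp (hc.continuousOn_inv_mul h2) fun t ht =>
        ((h1 _ h2).2 t ht).1).mono hsub)
    (by
      filter_upwards [hgood] with lam h1
      simp only [x, h1.1 τ ⟨hτ, le_rfl⟩, inv_mul_cancel]
      exact sub_self _)
    (by
      filter_upwards [hder, hlb] with lam h1 h2 t ht
      rw [← hrel (insertedMode f₁ f₂ τ lam) f₂ t _ fun g => insertedMode_of_mem ht]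
      exact h1 t ⟨hτ.trans ht.1, by linarith [ht.2]⟩)
    (by
      filter_upwards [hder, self_mem_nhdsWithin] with lam h1 h2 t ht
      rw [mem_Ioi] at h2
      rw [← hrel (insertedMode f₁ f₂ τ lam) f₁ t _ fun g => insertedMode_of_notMem
        fun h => absurd h.2 (not_lt.2 ht.1)]
      exact h1 t ⟨by linarith [ht.1], ht.2⟩)
    (by
      filter_upwards [hgood] with lam h1 t ht using (h1.2 t (hsub ht)).2)
    (by
      filter_upwards [hgood, hLc] with lam h1 h2
      refine ((h2.sub hLc0).mono hsub).congr fun t ht => ?_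
      simp only [(h1.2 t (hsub ht)).1]
      rfl)
    (by
      intro ε hε
      obtain ⟨δ, hδ, h⟩ := exists_uniform_linearization isCompact_Icc hU he
        (fun t ht y hy => hasFDerivAt_relativeField (ξ := ξ) (c := c) hf₁ ht hy)
        (continuousOn_relativeFieldDeriv hf₁ hc.cont hξ) hε
      refine ⟨δ, hδ, fun t ht y hy => ?_⟩
      have h1 := h t (hsub ht) (e + y) (by rwa [add_sub_cancel_left])
      rw [relativeField_chartOne, sub_self, sub_zero, add_sub_cancel_left] at h1
      exact h1)
    (by
      intro ε hε
      obtain ⟨δ, hδ, h⟩ := exists_uniform_linearization isCompact_Icc hU he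
        (fun t ht y hy => (differentiableAt_translate (f := fun g _ => L g) hL' (c t) ht hy).hasFDerivAt)
        (continuousOn_fderiv_translate (f := fun g _ => L g) hL' hc.cont) hε
      refine ⟨δ, hδ, fun t ht y hy => ?_⟩
      have h1 := h t (hsub ht) (e + y) (by rwa [add_sub_cancel_left])
      simp only [add_sub_cancel_left, e, chart_symm_chartOne, mul_one] at h1
      exact h1)
    (by
      have h1 := continuousOn_relativeField (ξ := ξ) hf₂ hc.cont hξ (τ, e) ⟨⟨hτ, hτb.le⟩, he⟩
      rw [ContinuousWithinAt, nhdsWithin_prod_eq, hU.nhdsWithin_eq he] at h1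
      simp only [e, relativeField_chartOne] at h1
      have h2 : Tendsto (fun p : ℝ × E => (p.1, e + p.2)) (𝓝[Icc τ b] τ ×ˢ 𝓝 0)
          (𝓝[Icc a b] τ ×ˢ 𝓝 e) := by
        refine (Tendsto.mono_left tendsto_fst le_rfl |>.mono_right
          (nhdsWithin_mono _ hsub)).prodMk ?_
        have h3 : Tendsto (fun y : E => e + y) (𝓝 0) (𝓝 (e + 0)) :=
          (continuous_const.add continuous_id).tendsto 0
        rw [add_zero] at h3
        exact h3.comp tendsto_snd
      have h4 := h1.comp h2
      simp only [Function.comp_def, ξ] at h4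
      exact h4)
    (fun t ht => (hK₁ t (hsub ht)).trans (le_max_left _ _))
    (fun t ht => (hK₂ t (hsub ht)).trans (le_max_right _ _))
    (fun t ht => (hR t (hsub ht)).mono hsub)
  have hbm : b ∈ Icc a b := ⟨hab, le_rfl⟩
  have hxO : (fun lam => x lam b) =O[𝓝[>] (0 : ℝ)] fun lam => lam := by
    refine Asymptotics.IsBigO.of_bound C ?_
    filter_upwards [hgood, self_mem_nhdsWithin] with lam h1 h2
    rw [Real.norm_of_nonneg (mem_Ioi.1 h2).le]
    exact (h1.2 b hbm).2
  -- The Fréchet remainder of `φ` at the endpoint is `o(‖x‖)`, and the displacement is `O(λ)`.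
  have hterm : (fun lam => φ (γ lam b) - φ (c b) - R b (x lam b)) =o[𝓝[>] (0 : ℝ)]
      fun lam => lam := by
    have h1 := (hasFDerivAt_chartGradient hφ (c b)).isLittleO
    rw [← hRb] at h1
    have h0 : Tendsto (fun lam : ℝ => lam) (𝓝[>] (0 : ℝ)) (𝓝 0) := nhdsWithin_le_nhds
    have h2 : Tendsto (fun lam => e + x lam b) (𝓝[>] (0 : ℝ)) (𝓝 e) := by
      have h3 := (hxO.trans_tendsto h0).const_add e
      rwa [add_zero] at h3
    have h3 := h1.comp_tendsto h2
    simp only [Function.comp_def, e, add_sub_cancel_left, chart_symm_chartOne, mul_one] at h3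
    refine (h3.trans_isBigO hxO).congr' ?_ EventuallyEq.rfl
    filter_upwards [hgood] with lam h4
    have h5 := (h4.2 b hbm).1
    simp only [e] at h5
    rw [h5]
  -- Dropping the point `λ = 0` itself lets all the estimates be used, as they hold for small `λ >
  -- 0`.
  rw [← hasDerivWithinAt_Ioi_iff_Ici, hasDerivWithinAt_iff_isLittleO]
  refine (key.add hterm).congr' ?_ (Eventually.of_forall fun lam => (sub_zero lam).symm)
  filter_upwards [hgood, hLc] with lam h1 h2
  have hcongr : ∫ t in τ..b, (L (c t * χ.symm (e + x lam t)) - L (c t)) =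
      ∫ t in τ..b, (L (γ lam t) - L (c t)) := by
    refine intervalIntegral.integral_congr fun t ht => ?_
    rw [uIcc_of_le hτb.le] at ht
    simp only [(h1.2 t (hsub ht)).1]
  rw [hcongr, cost_sub_cost φ hτ hτb.le h1.1 h2 hLc0, sub_zero, smul_eq_mul]
  ring

end LieSwitch

theorem corollary1 {E : Type*} [NormedAddCommGroup E] [NormedSpace ℝ E] [FiniteDimensional ℝ E]
    {G : Type*} [TopologicalSpace G] [ChartedSpace E G] [Group G]
    [LieGroup 𝓘(ℝ, E) ∞ G] [T2Space G]
    (f₁ f₂ : G → ℝ → GroupLieAlgebra 𝓘(ℝ, E) G) (L φ : G → ℝ)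
    (T₀ TN τ₀ : ℝ) (hT₀ : T₀ ≤ τ₀) (hTN : τ₀ < TN)
    (hf₁ : ContMDiffOn (M' := E) (𝓘(ℝ, E).prod 𝓘(ℝ, ℝ)) 𝓘(ℝ, E) 1
      (fun p : G × ℝ => f₁ p.1 p.2) (univ ×ˢ Icc T₀ TN))
    (hf₂ : ContMDiffOn (M' := E) (𝓘(ℝ, E).prod 𝓘(ℝ, ℝ)) 𝓘(ℝ, E) 1
      (fun p : G × ℝ => f₂ p.1 p.2) (univ ×ˢ Icc T₀ TN))
    (hL : ContMDiff 𝓘(ℝ, E) 𝓘(ℝ, ℝ) 1 L) (hφ : MDifferentiable 𝓘(ℝ, E) 𝓘(ℝ, ℝ) φ)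
    (g₀ : G) (γ : ℝ → ℝ → G)
    (hγ : ∀ᶠ lam in 𝓝[≥] (0 : ℝ),
      LieSwitch.IsTrajectory (LieSwitch.insertedMode f₁ f₂ τ₀ lam) T₀ TN g₀ (γ lam)) :
    (∃ ρ : ℝ → Module.Dual ℝ (GroupLieAlgebra 𝓘(ℝ, E) G),
      LieSwitch.IsCostate f₁ L φ T₀ TN (γ 0) ρ) ∧
    ∀ ρ : ℝ → Module.Dual ℝ (GroupLieAlgebra 𝓘(ℝ, E) G),
      LieSwitch.IsCostate f₁ L φ T₀ TN (γ 0) ρ →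
        HasDerivWithinAt (fun lam => LieSwitch.cost L φ T₀ TN (γ lam))
          (ρ τ₀ (f₂ (γ 0 τ₀) τ₀ - f₁ (γ 0 τ₀) τ₀)) (Ici 0) 0 := by

  -- The filter `𝓝[≥] 0` sees the point 0 itself, so the nominal curve is a trajectory too.
  have h0 := hγ.self_of_nhdsWithin self_mem_Ici
  rw [LieSwitch.insertedMode_zero] at h0
  refine ⟨LieSwitch.exists_isCostate (hT₀.trans hTN.le) hf₁ hL hφ h0.cont, fun ρ hρ => ?_⟩
  let R : ℝ → E →L[ℝ] ℝ := fun t => LinearMap.toContinuousLinearMap (E := E) (ρ t)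
  obtain ⟨hR, hRb⟩ := (LieSwitch.isCostate_iff hf₁ hL hφ R ρ fun t v => rfl).1 hρ
  exact LieSwitch.hasDerivWithinAt_cost (E := E) (f₁ := f₁) (f₂ := f₂) hT₀ hTN hf₁ hf₂ hL hφ h0 hγ
    hR hRb
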